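/- **Setting.** A graph has nodes and directed edges, with source and target maps. For a graph $T$, a $T$-typed graph is a graph $G$ with a morphism $t_G:G\to T$; morphisms of typed graphs commute with the typings, and monos are the injective ones. A rule $p=(L\xleftarrow{l}K\xrightarrow{r}R)$ is a span of monos of typed graphs. A constraint over $p$ is a mono $n:L\to N$; a mono (match) $m:L\to G$ satisfies $n$ if there is no mono $q:N\to G$ with $q\circ n=m$. The constraint $n$ is *incremental* if for any two factorizations $n=b_1\circ a_1=b_2\circ a_2$ into monos, through $X_1$ and $X_2$, there is a morphism $X_1\to X_2$ or $X_2\to X_1$ making both triangles commute. A conditional grammar $\mathcal{CG}=\langle TG,G_{in},P,\pi,\mathcal N\rangle$ consists of a type graph $TG$, a $TG$-typed start graph $G_{in}$, a set $P$ of rule names, a rule $\pi(p)$ and a set $\mathcal N(p)$ of constraints over it for each $p\in P$. We have $G\Rightarrow_{p,m}H$ if $m:L\to G$ is a mono that satisfies all constraints in $\mathcal N(p)$ and there is a diagram $G\leftarrow D\to H$ over $L\leftarrow K\to R$ consisting of two pushouts. The grammar is *safe* if all its rules, constraints and reachable graphs have injective typings. Let $\mathcal{CG}$ be safe with incremental constraints.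 The *shape* $n^-:L^-\to N^-$ of a constraint $n:L\to N$ consists of its body $N^-$, the smallest subgraph of $N$ that contains all items outside $n(L)$, and its border $L^-=N^-\cap L$. Both are regarded as subgraphs of $TG$, and shapes are identified accordingly. Assume that the set $sh$ of all shapes is finite, and fix an arbitrary enumeration of it. A shape is *foreign* to $p$ if it is not the shape of a constraint in $\mathcal N(p)$. **The enriched grammar $E(\mathcal{CG})$.** Its type graph $\overline{TG}$ is the colimit of the diagram made of $TG$ and of $TG\leftarrow L^-\to N^-$ for all shapes, with $in_{TG}:TG\to\overline{TG}$. A $TG$-typed graph is also $\overline{TG}$-typed, through $in_{TG}$. The *complement* $\overline N^-$ of a body is $N^-$ typed by the colimit injection. The *closure* $\overline G$ of a $TG$-typed graph $G$ is obtained by attaching to $G$, along $L^-$, the complement $\overline N^-$ for each shape with $L^-\subseteq G$ and $N^-\not\subseteq G$. The start graph of $E(\mathcal{CG})$ is $\overline{G_{in}}$. Each $p\in P$ yields a finite family of rules, all mapped to $p$ by $e_P$, as follows. In every step the shapes are processed one after the other, and each is applied to the current rule $L\leftarrow K\to R$. 0. For each shape of a constraint of $p$, let $\overline n:L\to\overline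 N$ be the pushout of $L^-\to\overline N^-$ along $L^-\to L$. If the current rule has a double-pushout diagram at $\overline n$ and there is no morphism $N^-\to R$, replace the rule by the derived one (the bottom span of the diagram). Otherwise replace it by $\overline N\leftarrow K\to R$. 1. For each foreign shape: if $N^-$ is in $L$, and $L^-$ but not $N^-$ is in $K$, attach $\overline N^-$ to $R$ along $L^-$. 2. For each foreign shape: if $N^-$ is in $R$, and $L^-$ but not $N^-$ is in $K$, attach $\overline N^-$ to $L$ along $L^-$. 3. For each foreign shape: if $L^-$ is in $R$ but not in $K$, and $N^-$ is not in $R$, attach $\overline N^-$ to $R$ along $L^-$. 4. Start with the one-element family containing the resulting rule. For each foreign shape whose border is two distinct nodes and whose body has just one more edge, joining them, and for each rule of the family, let $X=R\cap L^-$. If $X\neq L^-$ and $X$ is not in $K$, add to the family the rule $L'\leftarrow K'\to R''$. Here $R'$ is the pushout of $R\leftarrow X\to L^-$, $R''$ that of $R'\leftarrow L^-\to\overline N^-$, $K'$ is the pushout complement of $K\to R\to R'$, and $L'$ is the pushout of $L\leftarrow K\to K'$. The constraints of each rule so obtained are those of $p$, lifted by pushout along the embedding of the left-hand side of $p$ into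 the new one. A transformation by a rule $q$ of a family from a graph $G'$ is *maximal* if no rule of the same family that properly contains $q$ as a subrule has a match in $G'$. Let $e_{TG}^{<>}$ be the functor that pulls back typings along $in_{TG}$; it and $e_P$ form the morphism $e:E(\mathcal{CG})\to\mathcal{CG}$. **Theorem (reflection of derivations).** The morphism $e$ reflects derivations. For every conditional transformation $G\Rightarrow_{p,m}H$ in $\mathcal{CG}$ there are graphs $G',H'$ over $\overline{TG}$, a rule $p'$ of $E(\mathcal{CG})$ and a match $m':L_{p'}\to G'$ such that $G'\Rightarrow_{p',m'}H'$ in $E(\mathcal{CG})$ and this transformation is maximal, $e_P(p')=p$, $e_{TG}^{<>}(G')\cong G$ and $e_{TG}^{<>}(H')\cong H$. Moreover, one can take $G'=\overline G$ whenever the following hold: $G$ and $H$ are injectively typed (for instance, $G$ is reachable); $p$ does not delete and recreate an item, i.e. $K=L\cap R$; and $p$ deletes no item of the border of any foreign shape whose border is contained in $G$ while its body is not. -/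

import Mathlib

open CategoryTheory CategoryTheory.Limits

universe u v

noncomputable section

namespace GraphGrammar

/-! ## Graphs and typed graphs -/

/-- Directed unlabelled graphs. A functor `G` from the walking parallel pair to types is a set
`G.obj .zero` of edges, a set `G.obj .one` of nodes, and two maps (source `G.map .left`, target
`G.map .right`) from edges to nodes; a natural transformation is a pair of maps (on edges and on
nodes) that preserves sources and targets. Monos are the componentwise injective morphisms. -/
abbrev Graph := WalkingParallelPair ⥤ Type u

/-- The source of an edge. -/
def Graph.src (G : Graph.{u}) : G.obj .zero → G.obj .one := fun e => G.map .left e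

/-- The target of an edge. -/
def Graph.tgt (G : Graph.{u}) : G.obj .zero → G.obj .one := fun e => G.map .right e

/-- `T`-typed graphs: graphs `G` with a typing morphism `G ⟶ T` (available as `G.hom`);
morphisms are the graph morphisms that are consistent with the typing. -/
abbrev Typed (T : Graph.{u}) := Over T

/-- Pushouts of monos are monos. -/
theorem mono_inl {T : Graph.{u}} {A B C : Typed T} (f : A ⟶ B) (g : A ⟶ C) [Mono g] :
    Mono (pushout.inl f g) :=
  Adhesive.mono_of_isPushout_of_mono_right (IsPushout.of_hasPushout f g)

/-- Pushouts of monos are monos. -/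
theorem mono_inr {T : Graph.{u}} {A B C : Typed T} (f : A ⟶ B) (g : A ⟶ C) [Mono f] :
    Mono (pushout.inr f g) :=
  Adhesive.mono_of_isPushout_of_mono_left (IsPushout.of_hasPushout f g)

/-- Changing the type graph by postcomposition preserves monos. -/
theorem mono_map {T T' : Graph.{u}} (f : T ⟶ T') {A B : Typed T} (g : A ⟶ B) [Mono g] :
    Mono ((Over.map f).map g) := by
  have : Mono ((Over.map f).map g).left := by
    change Mono g.left
    infer_instance
  exact Over.mono_of_mono_left _

/-- The retyping functor `h^> ∘ g^<` of a span `T₁ ⟵ T₀ ⟶ T₂` of type graphs: pull the typing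
back along `g`, then postcompose it with `h`. -/
def retype {T₀ T₁ T₂ : Graph.{u}} (g : T₀ ⟶ T₁) (h : T₀ ⟶ T₂) : Typed T₁ ⥤ Typed T₂ :=
  Over.pullback g ⋙ Over.map h

/-! ## Rules, double-pushout transformations, constraints -/

/-- A rule: a span of monos of typed graphs. -/
structure Rule (T : Graph.{u}) where
  L : Typed T
  K : Typed T
  R : Typed T
  l : K ⟶ L
  r : K ⟶ R
  mono_l : Mono l
  mono_r : Mono r

/-- A double-pushout diagram over the rule `p` with left vertical morphism `m : L ⟶ G` and
with result `H`. -/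
structure DPO {T : Graph.{u}} (p : Rule T) {G : Typed T} (m : p.L ⟶ G) (H : Typed T) where
  D : Typed T
  g : D ⟶ G
  h : D ⟶ H
  k : p.K ⟶ D
  comatch : p.R ⟶ H
  left : IsPushout p.l k m g
  right : IsPushout p.r k comatch h

/-- The derived rule, the bottom span of a double-pushout diagram. -/
def DPO.derived {T : Graph.{u}} {p : Rule T} {G : Typed T} {m : p.L ⟶ G} {H : Typed T}
    (d : DPO p m H) : Rule T where
  L := G
  K := d.D
  R := H
  l := d.g
  r := d.h
  mono_l := by
    have := p.mono_l
    exact Adhesive.mono_of_isPushout_of_mono_left d.left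
  mono_r := by
    have := p.mono_r
    exact Adhesive.mono_of_isPushout_of_mono_left d.right

/-- `p` is a subrule of `q`: there are monos between the three graphs that commute with the
morphisms of the spans. -/
def Rule.Subrule {T : Graph.{u}} (p q : Rule T) : Prop :=
  ∃ (a : p.L ⟶ q.L) (b : p.K ⟶ q.K) (c : p.R ⟶ q.R), Mono a ∧ Mono b ∧ Mono c ∧
    p.l ≫ a = b ≫ q.l ∧ p.r ≫ c = b ≫ q.r

/-- A (negative) constraint over a rule with left-hand side `L`: a mono `n : L ⟶ N`. -/
structure Constraint {T : Graph.{u}} (L : Typed T) where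
  N : Typed T
  n : L ⟶ N
  mono_n : Mono n

/-- The match `m` satisfies the constraint `c`. -/
def Constraint.SatisfiedBy {T : Graph.{u}} {L G : Typed T} (c : Constraint L) (m : L ⟶ G) : Prop :=
  ¬ ∃ q : c.N ⟶ G, Mono q ∧ c.n ≫ q = m

/-- A constraint is incremental if any two decompositions of it into monos are comparable. -/
def Constraint.Incremental {T : Graph.{u}} {L : Typed T} (c : Constraint L) : Prop :=
  ∀ (X₁ X₂ : Typed T) (a₁ : L ⟶ X₁) (b₁ : X₁ ⟶ c.N) (a₂ : L ⟶ X₂) (b₂ : X₂ ⟶ c.N),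
    Mono a₁ → Mono b₁ → Mono a₂ → Mono b₂ → a₁ ≫ b₁ = c.n → a₂ ≫ b₂ = c.n →
    (∃ x : X₁ ⟶ X₂, a₁ ≫ x = a₂ ∧ x ≫ b₂ = b₁) ∨ (∃ x : X₂ ⟶ X₁, a₂ ≫ x = a₁ ∧ x ≫ b₁ = b₂)

/-- Retyping a constraint by postcomposition. -/
def Constraint.map {T T' : Graph.{u}} (f : T ⟶ T') {L : Typed T} (c : Constraint L) :
    Constraint ((Over.map f).obj L) where
  N := (Over.map f).obj c.N
  n := (Over.map f).map c.n
  mono_n := by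
    have := c.mono_n
    exact mono_map f c.n

/-- Lifting a constraint along a morphism of left-hand sides: the pushout of the constraint. -/
def Constraint.lift {T : Graph.{u}} {L L' : Typed T} (a : L ⟶ L') (c : Constraint L) :
    Constraint L' where
  N := pushout a c.n
  n := pushout.inl a c.n
  mono_n := by
    have := c.mono_n
    exact mono_inl a c.n

/-! ## Conditional graph grammars -/

/-- Conditional graph grammars `⟨TG, G_in, P, π, 𝒩⟩`. -/
structure CGG where
  TG : Graph.{u}
  Gin : Typed TG
  P : Type v
  rule : P → Rule TG
  nac : (p : P) → Set (Constraint (rule p).L)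

namespace CGG

variable (CG : CGG.{u, v})

/-- The conditional transformation `G ⇒_{p,m} H` exists. -/
def Step (p : CG.P) {G : Typed CG.TG} (m : (CG.rule p).L ⟶ G) (H : Typed CG.TG) : Prop :=
  Mono m ∧ (∀ c ∈ CG.nac p, c.SatisfiedBy m) ∧ Nonempty (DPO (CG.rule p) m H)

/-- The graphs that are reachable by conditional derivations. -/
inductive Reachable : Typed CG.TG → Prop
  | start : Reachable CG.Gin
  | step {G H : Typed CG.TG} (p : CG.P) (m : (CG.rule p).L ⟶ G) :
      Reachable G → CG.Step p m H → Reachable H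

/-- A grammar is safe if its rules, its constraints and all its reachable graphs have an
injective typing morphism. -/
def Safe : Prop :=
  (∀ p, Mono (CG.rule p).L.hom ∧ Mono (CG.rule p).K.hom ∧ Mono (CG.rule p).R.hom) ∧
  (∀ p, ∀ c ∈ CG.nac p, Mono c.N.hom) ∧
  (∀ G, CG.Reachable G → Mono G.hom)

end CGG

/-! ## Shapes of constraints -/

/-- A shape over `T`. In a safe grammar all typing morphisms are injective, so that the border
and the body of a constraint are, up to renaming, subgraphs of the type graph. -/
@[ext]
structure Shape (T : Graph.{u}) where
  border : Subfunctor T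
  body : Subfunctor T
  le : border ≤ body

namespace Shape

variable {T : Graph.{u}} (s : Shape T)

/-- The border as a typed graph. -/
def borderTyped : Typed T := Over.mk s.border.ι

/-- The body as a typed graph. -/
def bodyTyped : Typed T := Over.mk s.body.ι

/-- The shape as a morphism. -/
def incl : s.border.toFunctor ⟶ s.body.toFunctor := Subfunctor.homOfLe s.le

/-- The shapes of type `E`: the border consists of two distinct nodes, the body has in addition
a single edge from one to the other. -/
def IsTypeE : Prop :=
  ∃ e : T.obj .zero, T.src e ≠ T.tgt e ∧
    s.border.obj .one = {T.src e, T.tgt e} ∧ s.border.obj .zero = ∅ ∧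
    s.body.obj .one = {T.src e, T.tgt e} ∧ s.body.obj .zero = {e}

end Shape

/-- The smallest subgraph of `N` that contains all items of `N` outside the image of `L`. -/
def Constraint.negative {T : Graph.{u}} {L : Typed T} (c : Constraint L) : Subfunctor c.N.left :=
  sInf {S | ∀ (j : WalkingParallelPair) (x : c.N.left.obj j),
    x ∉ (Subfunctor.range c.n.left).obj j → x ∈ S.obj j}

/-- The shape of a constraint: the body is the smallest subgraph of `N` containing all negative
items, the border is its intersection with (the image of) `L`; both are identified with their
images in the type graph. -/
def Constraint.shape {T : Graph.{u}} {L : Typed T} (c : Constraint L) : Shape T where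
  border := (c.negative ⊓ Subfunctor.range c.n.left).image c.N.hom
  body := c.negative.image c.N.hom
  le := by
    rintro j _ ⟨x, hx, rfl⟩
    exact ⟨x, hx.1, rfl⟩

/-! ## Attaching a family of graphs along a family of subgraphs -/

section Attach

variable {C : Type*} [Category C] {ι : Type*} {X : C} {A B : ι → C} [HasCoproduct A]
  [HasCoproduct B] [HasPushouts C]

/-- The colimit of the diagram consisting of `X` and of `X ⟵ A i ⟶ B i` for all `i`, computed as
the pushout of `X ⟵ ∐ A ⟶ ∐ B`. -/
def attach (f : ∀ i, A i ⟶ X) (g : ∀ i, A i ⟶ B i) : C :=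
  pushout (Sigma.desc f) (Limits.Sigma.map g)

/-- The colimit injection of `X`. -/
def attachBase (f : ∀ i, A i ⟶ X) (g : ∀ i, A i ⟶ B i) : X ⟶ attach f g :=
  pushout.inl _ _

/-- The colimit injection of `B i`. -/
def attachPiece (f : ∀ i, A i ⟶ X) (g : ∀ i, A i ⟶ B i) (i : ι) : B i ⟶ attach f g :=
  Sigma.ι B i ≫ pushout.inr _ _

theorem attach_condition (f : ∀ i, A i ⟶ X) (g : ∀ i, A i ⟶ B i) (i : ι) :
    g i ≫ attachPiece f g i = f i ≫ attachBase f g := by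
  have h := congrArg (fun t => Sigma.ι A i ≫ t)
    (pushout.condition (f := Sigma.desc f) (g := Limits.Sigma.map g))
  simp only [colimit.ι_desc_assoc, Limits.ι_colimMap_assoc, Discrete.natTrans_app,
    Cofan.mk_ι_app, Limits.Sigma.map] at h
  exact h.symm

end Attach

/-! ## The enriched type graph -/

namespace CGG

variable (CG : CGG.{u, v})

/-- The shapes of the constraints of the rule `p`. -/
def ruleShapes (p : CG.P) : Set (Shape CG.TG) := {s | ∃ c ∈ CG.nac p, c.shape = s}

/-- All shapes of constraints of the grammar. -/
def shapes : Set (Shape CG.TG) := {s | ∃ p, s ∈ CG.ruleShapes p}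

/-- The enriched type graph: the colimit of the diagram made of the type graph, of all shapes and
of the typing morphisms of all borders. -/
def TGbar : Graph.{u} :=
  attach (fun s : CG.shapes => s.1.border.ι) (fun s : CG.shapes => s.1.incl)

/-- The injection of the type graph into the enriched type graph. -/
def inTG : CG.TG ⟶ CG.TGbar :=
  attachBase (fun s : CG.shapes => s.1.border.ι) (fun s : CG.shapes => s.1.incl)

/-- The colimit injection of the body of a shape into the enriched type graph. -/
def complTyping (s : CG.shapes) : s.1.body.toFunctor ⟶ CG.TGbar :=
  attachPiece (fun s : CG.shapes => s.1.border.ι) (fun s : CG.shapes => s.1.incl) s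

end CGG

/-- A shape `border ⟶ body` over an enriched type graph `T`, together with its complement
`border ⟶ compl`. -/
structure ComplShape (T : Graph.{u}) where
  border : Typed T
  body : Typed T
  compl : Typed T
  incl : border ⟶ body
  complIncl : border ⟶ compl
  mono_compl : Mono complIncl

namespace CGG

variable (CG : CGG.{u, v})

/-- A shape of the grammar over the enriched type graph, together with its complement: border and
body are typed through the original type graph, the body's complement is typed by the colimit
injection. -/
def complShape (s : CG.shapes) : ComplShape CG.TGbar where
  border := (Over.map CG.inTG).obj s.1.borderTyped
  body := (Over.map CG.inTG).obj s.1.bodyTyped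
  compl := Over.mk (CG.complTyping s)
  incl := Over.homMk s.1.incl (by simp [Shape.borderTyped, Shape.bodyTyped, Shape.incl])
  complIncl := Over.homMk s.1.incl
    (attach_condition (fun s : CG.shapes => s.1.border.ι) (fun s : CG.shapes => s.1.incl) s)
  mono_compl := by
    have h : Mono s.1.incl := by unfold Shape.incl; infer_instance
    exact @Over.mono_of_mono_left _ _ _ _ _ _ h

/-- The shapes whose complement has to be added to `G`: the border is contained in `G`, the body
is not. -/
def Missing (G : Typed CG.TG) : Type u :=
  {s : CG.shapes // Nonempty (s.1.borderTyped ⟶ G) ∧ IsEmpty (s.1.bodyTyped ⟶ G)}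

/-- The invariant closure of a graph over the original type graph: the body complements of all
missing shapes are attached along their borders. (If the typing of `G` is injective then the
morphism from a border to `G` is unique.) -/
def closure (G : Typed CG.TG) : Typed CG.TGbar :=
  attach (fun s : CG.Missing G => (Over.map CG.inTG).map s.2.1.some)
    (fun s : CG.Missing G => (CG.complShape s.1).complIncl)

end CGG

/-! ## The encoding of rules -/

/-- A rule over the enriched type graph with an embedding of the left-hand side `L₀` of the rule
from which it has been built. It stands for the conditional rule whose constraints are the
original constraints lifted along the embedding (lifting in several steps is lifting along the
composite). -/
structure Ext {T : Graph.{u}} (L₀ : Typed T) where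
  rule : Rule T
  emb : L₀ ⟶ rule.L

namespace Ext

variable {T : Graph.{u}} {L₀ : Typed T}

open Classical in
/-- One step of the construction of complemented rules, for the shape `w` of a constraint of the
rule. With `n : L ⟶ N` the complemented constraint, `N` the left-hand side with the body's
complement attached: if the rule can be applied at `n` and the body has no arrow to `R` then the
result is the derived rule, otherwise only the left-hand side becomes `N`. (The border of a shape
of a constraint of the rule always has a morphism to `L`; it is unique as `L` is typed
injectively.) -/
def complement (w : ComplShape T) (ρ : Ext L₀) : Ext L₀ :=
  if hβ : Nonempty (w.border ⟶ ρ.rule.L) then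
    if h : (∃ H, Nonempty (DPO ρ.rule (pushout.inl hβ.some w.complIncl) H)) ∧
        IsEmpty (w.body ⟶ ρ.rule.R) then
      { rule := h.1.choose_spec.some.derived
        emb := ρ.emb ≫ pushout.inl hβ.some w.complIncl }
    else
      { rule :=
          { L := pushout hβ.some w.complIncl
            K := ρ.rule.K
            R := ρ.rule.R
            l := ρ.rule.l ≫ pushout.inl hβ.some w.complIncl
            r := ρ.rule.r
            mono_l := by
              have := ρ.rule.mono_l
              have := w.mono_compl
              have := mono_inl hβ.some w.complIncl
              exact mono_comp _ _
            mono_r := ρ.rule.mono_r }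
        emb := ρ.emb ≫ pushout.inl hβ.some w.complIncl }
  else ρ

/-- Attach the body's complement to the right-hand side, along a morphism from the border. -/
def attachRight (w : ComplShape T) (ρ : Ext L₀) (b : w.border ⟶ ρ.rule.R) : Ext L₀ where
  rule :=
    { L := ρ.rule.L
      K := ρ.rule.K
      R := pushout b w.complIncl
      l := ρ.rule.l
      r := ρ.rule.r ≫ pushout.inl b w.complIncl
      mono_l := ρ.rule.mono_l
      mono_r := by
        have := ρ.rule.mono_r
        have := w.mono_compl
        have := mono_inl b w.complIncl
        exact mono_comp _ _ }
  emb := ρ.emb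

/-- Attach the body's complement to the left-hand side, along a morphism from the border. -/
def attachLeft (w : ComplShape T) (ρ : Ext L₀) (b : w.border ⟶ ρ.rule.L) : Ext L₀ where
  rule :=
    { L := pushout b w.complIncl
      K := ρ.rule.K
      R := ρ.rule.R
      l := ρ.rule.l ≫ pushout.inl b w.complIncl
      r := ρ.rule.r
      mono_l := by
        have := ρ.rule.mono_l
        have := w.mono_compl
        have := mono_inl b w.complIncl
        exact mono_comp _ _
      mono_r := ρ.rule.mono_r }
  emb := ρ.emb ≫ pushout.inl b w.complIncl

open Classical in
/-- Compensate body deletion: if the body is in `L`, the border is preserved (its morphism to `L`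
factors through `K`) and the body is not, the body's complement is added to `R`. (As `l` is mono,
a morphism to `L` factors through `K` if and only if its pullback along `l` is an iso.) -/
def compensateDeletion (ρ : Ext L₀) (w : ComplShape T) : Ext L₀ :=
  if h : ∃ k : w.border ⟶ ρ.rule.K, ∃ f : w.body ⟶ ρ.rule.L,
      k ≫ ρ.rule.l = w.incl ≫ f ∧ ¬ ∃ k' : w.body ⟶ ρ.rule.K, k' ≫ ρ.rule.l = f then
    ρ.attachRight w (h.choose ≫ ρ.rule.r)
  else ρ

open Classical in
/-- Compensate body creation: if the body is in `R`, the border is preserved (its morphism to `R`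
factors through `K`) and the body is not, the body's complement is added to `L`. -/
def compensateCreation (ρ : Ext L₀) (w : ComplShape T) : Ext L₀ :=
  if h : ∃ k : w.border ⟶ ρ.rule.K, ∃ f : w.body ⟶ ρ.rule.R,
      k ≫ ρ.rule.r = w.incl ≫ f ∧ ¬ ∃ k' : w.body ⟶ ρ.rule.K, k' ≫ ρ.rule.r = f then
    ρ.attachLeft w (h.choose ≫ ρ.rule.l)
  else ρ

open Classical in
/-- Complete border creation: if the border is in `R` but is not preserved, and the body is not
in `R`, the body's complement is added to `R`. -/
def completeBorder (ρ : Ext L₀) (w : ComplShape T) : Ext L₀ :=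
  if h : ∃ b : w.border ⟶ ρ.rule.R,
      (¬ ∃ k : w.border ⟶ ρ.rule.K, k ≫ ρ.rule.r = b) ∧ IsEmpty (w.body ⟶ ρ.rule.R) then
    ρ.attachRight w h.choose
  else ρ

/-- The intersection of two typed graphs, the pullback of their typing morphisms. -/
def inter (A B : Typed T) : Typed T := Over.mk (pullback.fst A.hom B.hom ≫ A.hom)

def interFst (A B : Typed T) : inter A B ⟶ A := Over.homMk (pullback.fst A.hom B.hom)

def interSnd (A B : Typed T) : inter A B ⟶ B :=
  Over.homMk (pullback.snd A.hom B.hom) (by simpa [inter] using pullback.condition.symm)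

/-- The situation in which the rule creates a part of the border of `w`, but not all of it: the
intersection `X` of `R` and the border is neither the border nor contained in `K`. The datum `K'`
is the pushout complement of `K ⟶ R ⟶ R'`, where `R'` is the pushout of `R ⟵ X ⟶ border`. -/
structure PartialBorder (w : ComplShape T) (ρ : Ext L₀) where
  not_iso : ¬ IsIso (interSnd ρ.rule.R w.border)
  not_preserved : ¬ ∃ k : inter ρ.rule.R w.border ⟶ ρ.rule.K,
    k ≫ ρ.rule.r = interFst ρ.rule.R w.border
  K' : Typed T
  k : ρ.rule.K ⟶ K'
  r' : K' ⟶ pushout (interFst ρ.rule.R w.border) (interSnd ρ.rule.R w.border)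
  isPushout : IsPushout ρ.rule.r k (pushout.inl _ _) r'

/-- The additional rule `L' ⟵ K' ⟶ R''` for a partially created border, with `L'` the pushout of
`L ⟵ K ⟶ K'` and `R''` the pushout of `R' ⟵ border ⟶ compl`. -/
def PartialBorder.extend {w : ComplShape T} {ρ : Ext L₀} (d : PartialBorder w ρ) : Ext L₀ where
  rule :=
    { L := pushout ρ.rule.l d.k
      K := d.K'
      R := pushout (pushout.inr (interFst ρ.rule.R w.border) (interSnd ρ.rule.R w.border))
        w.complIncl
      l := pushout.inr ρ.rule.l d.k
      r := d.r' ≫ pushout.inl _ _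
      mono_l := by
        have := ρ.rule.mono_l
        exact mono_inr _ _
      mono_r := by
        have := ρ.rule.mono_r
        have := Adhesive.mono_of_isPushout_of_mono_left d.isPushout
        have := w.mono_compl
        have := mono_inl (pushout.inr (interFst ρ.rule.R w.border)
          (interSnd ρ.rule.R w.border)) w.complIncl
        exact mono_comp _ _ }
  emb := ρ.emb ≫ pushout.inl ρ.rule.l d.k

open Classical in
/-- The additional rule for a partially created border, if there is one. -/
def extendPartial (w : ComplShape T) (ρ : Ext L₀) : Option (Ext L₀) :=
  if h : Nonempty (PartialBorder w ρ) then some h.some.extend else none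

/-- Complete partial border creation: for each shape of the list in turn, add to the family of
rules the additional rules of all its members. -/
def completePartial (ws : List (ComplShape T)) (ρ : Ext L₀) : List (Ext L₀) :=
  ws.foldl (fun rules w => rules ++ rules.filterMap (extendPartial w)) [ρ]

end Ext

namespace CGG

variable (CG : CGG.{u, v})

/-- A rule of the grammar, typed over the enriched type graph. -/
def ruleBar (p : CG.P) : Rule CG.TGbar where
  L := (Over.map CG.inTG).obj (CG.rule p).L
  K := (Over.map CG.inTG).obj (CG.rule p).K
  R := (Over.map CG.inTG).obj (CG.rule p).R
  l := (Over.map CG.inTG).map (CG.rule p).l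
  r := (Over.map CG.inTG).map (CG.rule p).r
  mono_l := by
    have := (CG.rule p).mono_l
    exact mono_map _ _
  mono_r := by
    have := (CG.rule p).mono_r
    exact mono_map _ _

/-- An enumeration of the (finitely many) shapes of the grammar, in an arbitrary order; it fixes
the order in which the constructions process the shapes. -/
structure Enumeration where
  list : List CG.shapes
  nodup : list.Nodup
  complete : ∀ s, s ∈ list

variable {CG}

open Classical in
/-- The shapes of the constraints of `p`. -/
def Enumeration.own (E : CG.Enumeration) (p : CG.P) : List CG.shapes :=
  E.list.filter fun s => s.1 ∈ CG.ruleShapes p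

open Classical in
/-- The shapes of the grammar that are not shapes of constraints of `p`. -/
def Enumeration.foreign (E : CG.Enumeration) (p : CG.P) : List CG.shapes :=
  E.list.filter fun s => s.1 ∉ CG.ruleShapes p

/-- The complemented rule of `p`. As the grammar is safe, a constraint over `p` is determined by
its shape, so that the shapes of the constraints of `p` are processed one by one. -/
def Enumeration.complemented (E : CG.Enumeration) (p : CG.P) : Ext (CG.ruleBar p).L :=
  (E.own p).foldl (fun ρ s => ρ.complement (CG.complShape s)) ⟨CG.ruleBar p, 𝟙 _⟩

open Classical in
/-- The family of invariant preserving rules obtained from the complemented rule of `p`. -/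
def Enumeration.family (E : CG.Enumeration) (p : CG.P) : List (Ext (CG.ruleBar p).L) :=
  let ws := (E.foreign p).map CG.complShape
  let ρ₁ := ws.foldl Ext.compensateDeletion (E.complemented p)
  let ρ₂ := ws.foldl Ext.compensateCreation ρ₁
  let ρ₃ := ws.foldl Ext.completeBorder ρ₂
  ρ₃.completePartial (((E.foreign p).filter fun s => s.1.IsTypeE).map CG.complShape)

/-- The enriched grammar. Its rule names are the pairs of a rule name `p` and an index of the
family of rules obtained from `p`. -/
def Enumeration.enriched (E : CG.Enumeration) : CGG.{u, v} where
  TG := CG.TGbar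
  Gin := CG.closure CG.Gin
  P := Σ p : CG.P, Fin (E.family p).length
  rule := fun q => ((E.family q.1).get q.2).rule
  nac := fun q => {c' | ∃ c ∈ CG.nac q.1,
    c' = (c.map CG.inTG).lift ((E.family q.1).get q.2).emb}

/-- The rule component `e_P` of the morphism from the enriched to the original grammar. -/
def Enumeration.eP (E : CG.Enumeration) : E.enriched.P → CG.P := Sigma.fst

/-- The retyping functor of the span `TGbar ⟵ TG ⟶ TG` of the morphism from the enriched to the
original grammar, whose left leg is `inTG` and whose right leg is the identity. -/
def Enumeration.eRetype (E : CG.Enumeration) : Typed E.enriched.TG ⥤ Typed CG.TG :=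
  retype (T₁ := E.enriched.TG) CG.inTG (𝟙 CG.TG)

/-- The maximality requirement for the application of the rules of the enriched grammar: no rule
of the same family that properly extends `q` has a match in `G`. -/
def Enumeration.Maximal (E : CG.Enumeration) (q : E.enriched.P) (G : Typed E.enriched.TG) : Prop :=
  ∀ q' : E.enriched.P, E.eP q' = E.eP q →
    (∃ m : (E.enriched.rule q').L ⟶ G, Mono m) →
    (E.enriched.rule q).Subrule (E.enriched.rule q') →
    (E.enriched.rule q').Subrule (E.enriched.rule q)

/-- The transformation `G ⇒_{p} H` is the image under the morphism `e` of a transformation of the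
enriched grammar that starts from `G'`. -/
def Enumeration.ReflectedFrom (E : CG.Enumeration) (p : CG.P) (G H : Typed CG.TG)
    (G' : Typed E.enriched.TG) : Prop :=
  ∃ (H' : Typed E.enriched.TG) (p' : E.enriched.P) (m' : (E.enriched.rule p').L ⟶ G'),
    E.enriched.Step p' m' H' ∧ E.Maximal p' G' ∧ E.eP p' = p ∧
    Nonempty (E.eRetype.obj G' ≅ G) ∧ Nonempty (E.eRetype.obj H' ≅ H)

end CGG

/-- The rule deletes and recreates no item: its interface is the intersection of both sides. -/
def Rule.NoRecreation {T : Graph.{u}} (p : Rule T) : Prop :=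
  IsPullback p.l.left p.r.left p.L.hom p.R.hom

/-- The rule deletes no item whose type belongs to `S`. -/
def Rule.Preserves {T : Graph.{u}} (p : Rule T) (S : Subfunctor T) : Prop :=
  S.preimage p.L.hom ≤ Subfunctor.range p.l.left

end GraphGrammar

end

/-!
The proof rests on one notion. Call the types in the image of `CG.inTG` old. A mono of graphs over
the enriched type graph is conservative (`IsConservative`) if it is onto on the items of old types.
Then `G' : Typed CG.TGbar` is mapped to `G` by the retyping functor as soon as there is a
conservative mono from `G` to `G'` (`nonempty_retype_iso`), and negative constraints are
reflected along such monos (`Constraint.SatisfiedBy.lift`).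

The encoding of a rule `p` up to the completion of borders attaches complements of bodies only, so
that it yields a rule `E.base p` which extends `p` by conservative monos (`E.base_spec`). Each other
member of the family of `p` arises from `E.base p` by adding context nodes of old types and created
items of new types (`Ext.NodeExtension`, `E.family_spec`).

Let `g` be a conservative mono from `G` to `G'`, and let the match of `p` extend to a match `m₁` of
`E.base p` in `G'`. Among the finitely many rules of the family that have some match in `G'`, choose
a maximal one with respect to the subrule relation. Its match can be rearranged so as to extend
`m₁`: a context node whose image is occupied by an item of `E.base p` is exchanged with that item,
which is the only one of its type (`Ext.NodeExtension.exists_match`). Pushout complements exist by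
the dangling condition, and the result is again a conservative extension of `H`
(`Ext.NodeExtension.exists_dpo`). This is `reflectedFrom_of_match`.

In general, `G'` is obtained by gluing `G` and the left-hand side of `E.base p` along that of `p`,
where the dangling condition is clear. If `G` is injectively typed, its closure is the subgraph of
the enriched type graph that consists of `G` and of the complements of all missing bodies
(`isUnion_closure`), and the left-hand side of `E.base p` is the one that consists of the left-hand
side of `p` and of the complements for some shapes `s`, each of which is the shape of a constraint
of `p` or has a body created by `p`. Such a body is missing in `G`: in the first case by the
constraint, in the second because `H` is injectively typed and `p` recreates nothing. So the match
exists, and the dangling condition is the assumption on the borders of the foreign missing shapes.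
-/

namespace GraphGrammar

/-! ### Items of typed graphs -/

section Items

variable {T : Graph.{u}}

/-- The action of a morphism of typed graphs on edges (`j = .zero`) or nodes (`j = .one`). -/
def ap {A B : Typed T} (f : A ⟶ B) {j : WalkingParallelPair} (x : A.left.obj j) : B.left.obj j :=
  f.left.app j x

/-- The type of an edge or a node of a typed graph. -/
def typ {A : Typed T} {j : WalkingParallelPair} (x : A.left.obj j) : T.obj j :=
  A.hom.app j x

@[simp]
theorem ap_id {A : Typed T} {j : WalkingParallelPair} (x : A.left.obj j) : ap (𝟙 A) x = x := rfl

@[simp]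
theorem ap_comp {A B C : Typed T} (f : A ⟶ B) (g : B ⟶ C) {j : WalkingParallelPair}
    (x : A.left.obj j) : ap (f ≫ g) x = ap g (ap f x) := rfl

@[simp]
theorem typ_ap {A B : Typed T} (f : A ⟶ B) {j : WalkingParallelPair} (x : A.left.obj j) :
    typ (ap f x) = typ x := by
  have h := congrArg (fun t => t.app j x) (Over.w f)
  exact h

theorem ap_map {A B : Typed T} (f : A ⟶ B) {i j : WalkingParallelPair} (e : i ⟶ j)
    (x : A.left.obj i) : ap f (A.left.map e x) = B.left.map e (ap f x) :=
  NatTrans.naturality_apply f.left e x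

theorem hom_ext_ap {A B : Typed T} {f g : A ⟶ B}
    (h : ∀ (j : WalkingParallelPair) (x : A.left.obj j), ap f x = ap g x) : f = g := by
  ext j x
  exact h j x

theorem Graph.app_injective {A B : Graph.{u}} (f : A ⟶ B) [Mono f] (j : WalkingParallelPair) :
    Function.Injective (f.app j) :=
  (mono_iff_injective _).1 inferInstance

theorem Graph.mono_of_injective {A B : Graph.{u}} (f : A ⟶ B)
    (h : ∀ j, Function.Injective (f.app j)) : Mono f := by
  have : ∀ j, Mono (f.app j) := fun j => (mono_iff_injective _).2 (h j)
  exact NatTrans.mono_of_mono_app f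

theorem ap_injective {A B : Typed T} (f : A ⟶ B) [Mono f] {j : WalkingParallelPair} :
    Function.Injective (ap f (j := j)) :=
  Graph.app_injective f.left j

theorem mono_of_ap_injective {A B : Typed T} (f : A ⟶ B)
    (h : ∀ j, Function.Injective (ap f (j := j))) : Mono f := by
  have : Mono f.left := Graph.mono_of_injective _ h
  exact Over.mono_of_mono_left f

theorem typ_injective {A : Typed T} (h : Mono A.hom) {j : WalkingParallelPair} :
    Function.Injective (typ (A := A) (j := j)) :=
  Graph.app_injective A.hom j

theorem mono_of_typ_injective {A B : Typed T} (f : A ⟶ B) (h : Mono A.hom) : Mono f := by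
  refine mono_of_ap_injective f fun j x y hxy => typ_injective h ?_
  rw [← typ_ap f x, hxy, typ_ap]

theorem hom_subsingleton {A B : Typed T} (h : Mono B.hom) (f g : A ⟶ B) : f = g :=
  hom_ext_ap fun j x => typ_injective h (by simp)

/-- A morphism factors through a mono as soon as its image does. -/
theorem exists_lift {A B C : Typed T} (f : A ⟶ C) (g : B ⟶ C) [Mono g]
    (h : ∀ (j : WalkingParallelPair) (x : A.left.obj j), ∃ y, ap g y = ap f x) :
    ∃ k : A ⟶ B, k ≫ g = f := by
  choose k hk using h
  have hnat : ∀ {i j : WalkingParallelPair} (e : i ⟶ j) (x : A.left.obj i),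
      k j (A.left.map e x) = B.left.map e (k i x) := by
    intro i j e x
    apply ap_injective g
    rw [hk, ap_map, ap_map, hk]
  let kl : A.left ⟶ B.left :=
    { app := fun j => ↾(k j)
      naturality := fun i j e => by
        ext x
        exact hnat e x }
  have hkl : kl ≫ g.left = f.left := by
    ext j x
    exact hk j x
  refine ⟨Over.homMk kl ?_, ?_⟩
  · rw [← Over.w g, ← Category.assoc, hkl, Over.w f]
  · ext j x
    exact hk j x

/-- If the typing of `B` is injective, a morphism to `B` is an inclusion of subgraphs of the type
graph. -/
theorem exists_hom_of_typ {A B : Typed T} (hB : Mono B.hom)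
    (h : ∀ (j : WalkingParallelPair) (x : A.left.obj j), ∃ y : B.left.obj j, typ y = typ x) :
    Nonempty (A ⟶ B) := by
  let b : B ⟶ Over.mk (𝟙 T) := Over.homMk B.hom
  obtain ⟨k, -⟩ := exists_lift (Over.homMk A.hom : A ⟶ Over.mk (𝟙 T)) b h
  exact ⟨k⟩

/-! ### Pushouts of monos -/

section Pushouts

variable {A B C D : Typed T} {f : A ⟶ B} {g : A ⟶ C} {h : B ⟶ D} {k : C ⟶ D}

theorem isPushout_app (H : IsPushout f g h k) (j : WalkingParallelPair) :
    IsPushout (f.left.app j) (g.left.app j) (h.left.app j) (k.left.app j) :=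
  (H.map (Over.forget T)).app j

theorem ap_comm (H : IsPushout f g h k) {j : WalkingParallelPair} (x : A.left.obj j) :
    ap h (ap f x) = ap k (ap g x) := by
  rw [← ap_comp, H.w, ap_comp]

theorem pushout_surjective (H : IsPushout f g h k) {j : WalkingParallelPair} (x : D.left.obj j) :
    (∃ b, ap h b = x) ∨ ∃ c, ap k c = x :=
  Types.eq_or_eq_of_isPushout (isPushout_app H j) x

theorem pushout_inter [Mono f] (H : IsPushout f g h k) {j : WalkingParallelPair}
    {b : B.left.obj j} {c : C.left.obj j} (e : ap h b = ap k c) :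
    ∃ a, ap f a = b ∧ ap g a = c :=
  (Types.pushoutCocone_inl_eq_inr_iff_of_isColimit (isPushout_app H j).isColimit
    (Graph.app_injective f.left j) b c).1 e

/-- A commutative square of monos is a pushout if it is an intersection and a union. -/
theorem isPushout_of_union [Mono f] [Mono h] [Mono k] (w : f ≫ h = g ≫ k)
    (surj : ∀ (j : WalkingParallelPair) (x : D.left.obj j), (∃ b, ap h b = x) ∨ ∃ c, ap k c = x)
    (inter : ∀ (j : WalkingParallelPair) (b : B.left.obj j) (c : C.left.obj j),
      ap h b = ap k c → ∃ a, ap f a = b ∧ ap g a = c) : IsPushout f g h k := by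
  refine IsPushout.of_map (Over.forget T) w ?_
  refine IsPushout.of_forall_isPushout_app fun j => ?_
  refine Types.isPushout_of_isPullback_of_mono' ?_ ?_ ?_
  · refine (Types.isPullback_iff _ _ _ _).2 ⟨?_, ?_, ?_⟩
    · ext x
      exact congrArg (fun t : A ⟶ D => ap t x) w
    · intro x y hxy
      exact ap_injective f hxy.1
    · intro b c hbc
      exact inter j b c hbc
  · refine Set.eq_univ_of_forall fun x => ?_
    rcases surj j x with ⟨b, hb⟩ | ⟨c, hc⟩
    · exact Or.inl ⟨b, hb⟩
    · exact Or.inr ⟨c, hc⟩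
  · intro x y _ _ hxy
    exact ap_injective k hxy

end Pushouts

/-- The pushout complement of a match `m` of `l : K ⟶ L` exists if no edge outside the match is
incident with a deleted node (the dangling condition). -/
theorem exists_pushoutComplement {K L G : Typed T} (l : K ⟶ L) (m : L ⟶ G) [Mono l] [Mono m]
    (dangling : ∀ e : G.left.obj .zero, (¬ ∃ x, ap m x = e) →
      ∀ (i : WalkingParallelPair.zero ⟶ .one) (v : L.left.obj .one),
        ap m v = G.left.map i e → ∃ k, ap l k = v) :
    ∃ (D : Typed T) (k : K ⟶ D) (g : D ⟶ G), Mono g ∧ IsPushout l k m g := by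
  have key : ∀ (i : WalkingParallelPair.zero ⟶ .one) (e : G.left.obj .zero),
      (∀ y, ap m y = e → ∃ k, ap l k = y) →
      ∀ y, ap m y = G.left.map i e → ∃ k, ap l k = y := by
    intro i e he y hy
    by_cases hm : ∃ x, ap m x = e
    · obtain ⟨x, rfl⟩ := hm
      obtain ⟨k, rfl⟩ := he x rfl
      refine ⟨K.left.map i k, ap_injective m ?_⟩
      rw [ap_map, ap_map, hy]
    · exact dangling e hm i y hy
  let S : Subfunctor G.left :=
    { obj := fun j => {x | ∀ y, ap m y = x → ∃ k, ap l k = y}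
      map := by
        rintro U V (_ | _ | _) e he
        · exact key WalkingParallelPairHom.left e he
        · exact key WalkingParallelPairHom.right e he
        · intro y hy
          refine he y (hy.trans ?_)
          change G.left.map (𝟙 _) e = e
          simp }
  let g : Over.mk (S.ι ≫ G.hom) ⟶ G := Over.homMk S.ι
  have hg : Mono g := mono_of_ap_injective g fun j x y hxy => Subtype.ext hxy
  obtain ⟨k, hk⟩ : ∃ k, k ≫ g = l ≫ m := by
    refine exists_lift (l ≫ m) g fun j x => ⟨⟨ap (l ≫ m) x, ?_⟩, rfl⟩
    intro y hy
    exact ⟨x, (ap_injective m hy).symm⟩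
  refine ⟨_, k, g, hg, isPushout_of_union hk.symm ?_ ?_⟩
  · intro j x
    by_cases hx : ∃ y, ap m y = x
    · exact Or.inl hx
    · exact Or.inr ⟨⟨x, fun y hy => absurd ⟨y, hy⟩ hx⟩, rfl⟩
  · intro j b c hbc
    obtain ⟨a, rfl⟩ := c.2 b hbc
    refine ⟨a, rfl, ap_injective g ?_⟩
    rw [← hbc, ← ap_comp, ← ap_comp, hk]

/-- The colimit injections into an attachment are jointly surjective. -/
theorem attach_surjective {ι : Type u} {X : Typed T} {A B : ι → Typed T}
    (f : ∀ i, A i ⟶ X) (g : ∀ i, A i ⟶ B i) {j : WalkingParallelPair}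
    (x : (attach f g).left.obj j) :
    (∃ y, ap (attachBase f g) y = x) ∨ ∃ i y, ap (attachPiece f g i) y = x := by
  let S : Subfunctor (attach f g).left :=
    { obj := fun j => {x | (∃ y, ap (attachBase f g) y = x) ∨
        ∃ i y, ap (attachPiece f g i) y = x}
      map := by
        rintro U V e _ (⟨y, rfl⟩ | ⟨i, y, rfl⟩)
        · exact Or.inl ⟨_, ap_map _ e y⟩
        · exact Or.inr ⟨i, _, ap_map _ e y⟩ }
  let s : Over.mk (S.ι ≫ (attach f g).hom) ⟶ attach f g := Over.homMk S.ι
  have hs : Mono s := mono_of_ap_injective s fun j x y hxy => Subtype.ext hxy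
  obtain ⟨b, hb⟩ : ∃ b, b ≫ s = attachBase f g :=
    exists_lift _ s fun j x => ⟨⟨_, Or.inl ⟨x, rfl⟩⟩, rfl⟩
  have hp : ∀ i, ∃ p, p ≫ s = attachPiece f g i := fun i =>
    exists_lift _ s fun j x => ⟨⟨_, Or.inr ⟨i, x, rfl⟩⟩, rfl⟩
  choose p hp using hp
  have w : Sigma.desc f ≫ b = Limits.Sigma.map g ≫ Sigma.desc p := by
    refine Sigma.hom_ext _ _ fun i => ?_
    rw [← cancel_mono s]
    simp [hb, hp, attach_condition]
  have hr : pushout.desc b (Sigma.desc p) w ≫ s = 𝟙 (attach f g) := by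
    refine pushout.hom_ext ?_ (Sigma.hom_ext _ _ fun i => ?_)
    · rw [pushout.inl_desc_assoc, hb]
      exact (Category.comp_id _).symm
    · rw [pushout.inr_desc_assoc, Sigma.ι_desc_assoc, hp]
      exact congrArg _ (Category.comp_id _).symm
  have hx := congrArg (fun t : attach f g ⟶ attach f g => ap t x) hr
  simp only [ap_id] at hx
  rw [← hx]
  exact (ap (pushout.desc b (Sigma.desc p) w) x).2

end Items

/-! ### The enriched type graph -/

section Attach

variable {C : Type*} [Category C] {ι : Type*} {X : C} {A B : ι → C} [HasCoproduct A]
  [HasCoproduct B] [HasPushouts C]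

theorem exists_attach_desc (f : ∀ i, A i ⟶ X) (g : ∀ i, A i ⟶ B i) {Z : C} (a : X ⟶ Z)
    (b : ∀ i, B i ⟶ Z) (w : ∀ i, f i ≫ a = g i ≫ b i) :
    ∃ d : attach f g ⟶ Z, attachBase f g ≫ d = a ∧ ∀ i, attachPiece f g i ≫ d = b i := by
  have w' : Sigma.desc f ≫ a = Limits.Sigma.map g ≫ Sigma.desc b :=
    Sigma.hom_ext _ _ fun i => by simp [w]
  refine ⟨pushout.desc a (Sigma.desc b) w', pushout.inl_desc _ _ _, fun i => ?_⟩
  exact (Category.assoc _ _ _).trans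
    ((congrArg _ (pushout.inr_desc _ _ _)).trans (Sigma.ι_desc _ _))

end Attach

namespace CGG

variable (CG : CGG.{u, v})

/-- The enriched type graph folds back onto the original one. -/
theorem exists_fold : ∃ d : CG.TGbar ⟶ CG.TG, CG.inTG ≫ d = 𝟙 _ ∧
    ∀ s : CG.shapes, CG.complTyping s ≫ d = s.1.body.ι :=
  exists_attach_desc _ _ _ _ fun s => by simp [Shape.incl]

theorem mono_inTG : Mono CG.inTG := by
  obtain ⟨d, hd, -⟩ := CG.exists_fold
  have : Mono (CG.inTG ≫ d) := by rw [hd]; infer_instance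
  exact mono_of_mono _ d

theorem mono_complTyping (s : CG.shapes) : Mono (CG.complTyping s) := by
  obtain ⟨d, -, hd⟩ := CG.exists_fold
  have : Mono (CG.complTyping s ≫ d) := by rw [hd]; infer_instance
  exact mono_of_mono _ d

open Classical in
/-- Folding the complements of all bodies but that of `s` onto the original type graph. -/
theorem exists_double (s : CG.shapes) :
    ∃ d : CG.TGbar ⟶ pushout s.1.border.ι s.1.incl,
      CG.inTG ≫ d = pushout.inl _ _ ∧ CG.complTyping s ≫ d = pushout.inr _ _ ∧
      ∀ s' : CG.shapes, s' ≠ s → CG.complTyping s' ≫ d = s'.1.body.ι ≫ pushout.inl _ _ := by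
  obtain ⟨d, h₁, h₂⟩ := exists_attach_desc (fun s : CG.shapes => s.1.border.ι)
    (fun s : CG.shapes => s.1.incl) (pushout.inl s.1.border.ι s.1.incl)
    (fun s' => if h : s' = s then eqToHom (by rw [h]) ≫ pushout.inr s.1.border.ι s.1.incl
      else s'.1.body.ι ≫ pushout.inl s.1.border.ι s.1.incl) (by
      intro s'
      split_ifs with h
      · subst h
        simp [pushout.condition]
      · rw [← Category.assoc]
        simp [Shape.incl])
  refine ⟨d, h₁, ?_, ?_⟩
  · have h := h₂ s
    simp only [dif_pos rfl, eqToHom_refl, Category.id_comp] at h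
    exact h
  · intro s' hs'
    have h := h₂ s'
    rw [dif_neg hs'] at h
    exact h

theorem mem_border_of_inl_eq_inr (s : CG.shapes) {j : WalkingParallelPair}
    {x : CG.TG.obj j} {y : s.1.body.toFunctor.obj j}
    (h : (pushout.inl s.1.border.ι s.1.incl).app j x =
      (pushout.inr s.1.border.ι s.1.incl).app j y) :
    ∃ z, s.1.incl.app j z = y := by
  have H := (IsPushout.of_hasPushout s.1.border.ι s.1.incl).app j
  obtain ⟨z, -, hz⟩ := (Types.pushoutCocone_inl_eq_inr_iff_of_isColimit H.isColimit
    (Graph.app_injective s.1.border.ι j) x y).1 h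
  exact ⟨z, hz⟩

/-- An item of a body's complement has an original type only if it lies in the border. -/
theorem mem_border_of_complTyping_eq_inTG (s : CG.shapes) {j : WalkingParallelPair}
    {x : CG.TG.obj j} {y : s.1.body.toFunctor.obj j}
    (h : CG.inTG.app j x = (CG.complTyping s).app j y) : ∃ z, s.1.incl.app j z = y := by
  obtain ⟨d, h₁, h₂, -⟩ := CG.exists_double s
  refine CG.mem_border_of_inl_eq_inr s (x := x) ?_
  rw [← h₁, ← h₂, NatTrans.comp_app_apply, NatTrans.comp_app_apply, h]

/-- The complements of distinct bodies share border items only. -/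
theorem mem_border_of_complTyping_eq (s s' : CG.shapes) (hs : s' ≠ s) {j : WalkingParallelPair}
    {y : s.1.body.toFunctor.obj j} {y' : s'.1.body.toFunctor.obj j}
    (h : (CG.complTyping s').app j y' = (CG.complTyping s).app j y) :
    ∃ z, s.1.incl.app j z = y := by
  obtain ⟨d, -, h₂, h₃⟩ := CG.exists_double s
  refine CG.mem_border_of_inl_eq_inr s (x := s'.1.body.ι.app j y') ?_
  rw [← h₂, ← NatTrans.comp_app_apply, ← h₃ s' hs, NatTrans.comp_app_apply,
    NatTrans.comp_app_apply, h]

end CGG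

/-! ### Morphisms that add only items of new types -/

section Conservative

variable {T : Graph.{u}} (O : Subfunctor T)

/-- All items of `A` have a type in `O`. -/
def TypedIn (A : Typed T) : Prop :=
  ∀ (j : WalkingParallelPair) (x : A.left.obj j), typ x ∈ O.obj j

/-- A mono that is onto on the items with a type in `O`: it is an isomorphism when restricted to
the types in `O`. -/
structure IsConservative {A B : Typed T} (f : A ⟶ B) : Prop where
  mono : Mono f
  surj : ∀ (j : WalkingParallelPair) (x : B.left.obj j), typ x ∈ O.obj j → ∃ y, ap f y = x

namespace IsConservative

variable {O} {A B C D : Typed T}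

theorem id : IsConservative O (𝟙 A) := ⟨inferInstance, fun _ x _ => ⟨x, rfl⟩⟩

theorem comp {f : A ⟶ B} {g : B ⟶ C} (hf : IsConservative O f) (hg : IsConservative O g) :
    IsConservative O (f ≫ g) := by
  have := hf.mono
  have := hg.mono
  refine ⟨mono_comp f g, fun j x hx => ?_⟩
  obtain ⟨y, rfl⟩ := hg.surj j x hx
  obtain ⟨z, rfl⟩ := hf.surj j y (by simpa using hx)
  exact ⟨z, rfl⟩

/-- Gluing items of new types to `B` along `f` adds items of new types only. -/
theorem of_isPushout {f : A ⟶ B} {g : A ⟶ C} {h : B ⟶ D} {k : C ⟶ D} (H : IsPushout f g h k)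
    (hg : IsConservative O g) : IsConservative O h := by
  have := hg.mono
  refine ⟨Adhesive.mono_of_isPushout_of_mono_right H, fun j x hx => ?_⟩
  rcases pushout_surjective H x with hb | ⟨c, rfl⟩
  · exact hb
  · obtain ⟨a, rfl⟩ := hg.surj j c (by simpa using hx)
    exact ⟨ap f a, ap_comm H a⟩

theorem of_isPushout_complement {f : A ⟶ B} {g : A ⟶ C} {h : B ⟶ D} {k : C ⟶ D} [Mono f]
    (H : IsPushout f g h k) (hh : IsConservative O h) : IsConservative O g := by
  have := hh.mono
  have : Mono (g ≫ k) := by rw [← H.w]; infer_instance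
  refine ⟨mono_of_mono g k, fun j x hx => ?_⟩
  obtain ⟨b, hb⟩ := hh.surj j (ap k x) (by simpa using hx)
  obtain ⟨a, -, ha⟩ := pushout_inter H hb
  exact ⟨a, ha⟩

theorem exists_lift {f : A ⟶ B} (hf : IsConservative O f) (hC : TypedIn O C) (g : C ⟶ B) :
    ∃ h : C ⟶ A, h ≫ f = g := by
  have := hf.mono
  exact GraphGrammar.exists_lift g f fun j x => hf.surj j _ (by simpa using hC j x)

/-- If the items of `A` with types in `O` are determined by their types, so are those of `B`. -/
theorem eq_of_typ_eq {f : A ⟶ B} (hf : IsConservative O f) (hA : Mono A.hom)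
    {j : WalkingParallelPair} {x y : B.left.obj j} (hx : typ x ∈ O.obj j) (h : typ x = typ y) :
    x = y := by
  obtain ⟨x, rfl⟩ := hf.surj j x hx
  obtain ⟨y, rfl⟩ := hf.surj j y (h ▸ hx)
  rw [typ_injective hA (by simpa using h : typ x = typ y)]

end IsConservative

/-- The border and the body of the shape `w` are (up to isomorphism) subgraphs of `O`, and its
complement meets `O` in the border only. -/
structure ComplShape.IsFresh (w : ComplShape T) : Prop where
  border : TypedIn O w.border
  body : TypedIn O w.body
  mono_border : Mono w.border.hom
  mono_body : Mono w.body.hom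
  complIncl : IsConservative O w.complIncl

namespace Ext

/-- The rule `ρ` extends the rule `P` by items of types outside `O` only. -/
def IsConservative (P : Rule T) (ρ : Ext P.L) : Prop :=
  ∃ (κ : P.K ⟶ ρ.rule.K) (ϱ : P.R ⟶ ρ.rule.R), GraphGrammar.IsConservative O ρ.emb ∧
    GraphGrammar.IsConservative O κ ∧ GraphGrammar.IsConservative O ϱ ∧
    P.l ≫ ρ.emb = κ ≫ ρ.rule.l ∧ P.r ≫ ϱ = κ ≫ ρ.rule.r

variable {O} {P : Rule T} {w : ComplShape T}

theorem isConservative_base : IsConservative O P ⟨P, 𝟙 _⟩ :=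
  ⟨𝟙 _, 𝟙 _, .id, .id, .id, by simp, by simp⟩

variable {ρ : Ext P.L}

theorem isConservative_complement (h : IsConservative O P ρ) (hw : w.IsFresh O) :
    IsConservative O P (ρ.complement w) := by
  obtain ⟨κ, ϱ, hemb, hκ, hϱ, hl, hr⟩ := h
  have := ρ.rule.mono_l
  unfold complement
  split_ifs with hβ h
  · have hinl := IsConservative.of_isPushout (IsPushout.of_hasPushout hβ.some w.complIncl)
      hw.complIncl
    set d := h.1.choose_spec.some with hd
    have hk := IsConservative.of_isPushout_complement d.left hinl
    have hc := IsConservative.of_isPushout d.right hk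
    refine ⟨κ ≫ d.k, ϱ ≫ d.comatch, hemb.comp hinl, hκ.comp hk, hϱ.comp hc, ?_, ?_⟩
    · change P.l ≫ ρ.emb ≫ _ = (κ ≫ d.k) ≫ d.g
      rw [Category.assoc, ← d.left.w, reassoc_of% hl]
    · change P.r ≫ ϱ ≫ d.comatch = (κ ≫ d.k) ≫ d.h
      rw [Category.assoc, ← d.right.w, reassoc_of% hr]
  · have hinl := IsConservative.of_isPushout (IsPushout.of_hasPushout hβ.some w.complIncl)
      hw.complIncl
    exact ⟨κ, ϱ, hemb.comp hinl, hκ, hϱ, by simp [reassoc_of% hl], hr⟩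
  · exact ⟨κ, ϱ, hemb, hκ, hϱ, hl, hr⟩

theorem isConservative_attachRight (h : IsConservative O P ρ) (hw : w.IsFresh O)
    (b : w.border ⟶ ρ.rule.R) : IsConservative O P (ρ.attachRight w b) := by
  obtain ⟨κ, ϱ, hemb, hκ, hϱ, hl, hr⟩ := h
  have hinl := IsConservative.of_isPushout (IsPushout.of_hasPushout b w.complIncl) hw.complIncl
  exact ⟨κ, ϱ ≫ pushout.inl b w.complIncl, hemb, hκ, hϱ.comp hinl, hl,
    by simp [attachRight, reassoc_of% hr]⟩

theorem isConservative_attachLeft (h : IsConservative O P ρ) (hw : w.IsFresh O)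
    (b : w.border ⟶ ρ.rule.L) : IsConservative O P (ρ.attachLeft w b) := by
  obtain ⟨κ, ϱ, hemb, hκ, hϱ, hl, hr⟩ := h
  have hinl := IsConservative.of_isPushout (IsPushout.of_hasPushout b w.complIncl) hw.complIncl
  exact ⟨κ, ϱ, hemb.comp hinl, hκ, hϱ, by simp [attachLeft, reassoc_of% hl], hr⟩

theorem isConservative_compensateDeletion (h : IsConservative O P ρ) (hw : w.IsFresh O) :
    IsConservative O P (ρ.compensateDeletion w) := by
  unfold compensateDeletion
  split_ifs
  exacts [isConservative_attachRight h hw _, h]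

theorem isConservative_compensateCreation (h : IsConservative O P ρ) (hw : w.IsFresh O) :
    IsConservative O P (ρ.compensateCreation w) := by
  unfold compensateCreation
  split_ifs
  exacts [isConservative_attachLeft h hw _, h]

theorem isConservative_completeBorder (h : IsConservative O P ρ) (hw : w.IsFresh O) :
    IsConservative O P (ρ.completeBorder w) := by
  unfold completeBorder
  split_ifs
  exacts [isConservative_attachRight h hw _, h]

end Ext
end Conservative

/-! ### The left-hand sides of the complemented rules -/

section LeftHandSide

variable {T : Graph.{u}} (O : Subfunctor T) {ι : Type*} (W : ι → ComplShape T)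

/-- The complements of a family of shapes are independent: each is a subgraph of the type graph,
distinct ones meet in `O` only, and each meets `O` in its border. -/
structure Independent : Prop where
  isFresh : ∀ s, (W s).IsFresh O
  mono_compl : ∀ s, Mono (W s).compl.hom
  meet : ∀ s s', s ≠ s' → ∀ (j : WalkingParallelPair) (x : (W s).compl.left.obj j)
    (x' : (W s').compl.left.obj j), typ x = typ x' → typ x ∈ O.obj j

/-- As a subgraph of the type graph, `L` is the union of `L₀` and of the complements of the shapes
in `S`. -/
structure IsUnion (L₀ : Typed T) (S : Set ι) (L : Typed T) : Prop where
  mono : Mono L.hom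
  mem_iff : ∀ (j : WalkingParallelPair) (t : T.obj j), (∃ x : L.left.obj j, typ x = t) ↔
    (∃ x : L₀.left.obj j, typ x = t) ∨ ∃ s ∈ S, ∃ x : (W s).compl.left.obj j, typ x = t

variable {O W} {L₀ : Typed T} {S : Set ι} {L : Typed T}

theorem isUnion_empty (h : Mono L₀.hom) : IsUnion W L₀ ∅ L₀ :=
  ⟨h, by simp⟩

theorem IsUnion.attach (hW : Independent O W) (hL₀ : TypedIn O L₀) (h : IsUnion W L₀ S L) {s : ι}
    (hs : s ∉ S) (b : (W s).border ⟶ L) :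
    IsUnion W L₀ (insert s S) (pushout b (W s).complIncl) := by
  have H := IsPushout.of_hasPushout b (W s).complIncl
  have hc := (hW.isFresh s).complIncl
  have key : ∀ {j : WalkingParallelPair} (x : L.left.obj j) (y : (W s).compl.left.obj j),
      typ x = typ y → ap (pushout.inl b (W s).complIncl) x
        = ap (pushout.inr b (W s).complIncl) y := by
    intro j x y hxy
    have hy : typ y ∈ O.obj j := by
      rcases (h.mem_iff j (typ x)).1 ⟨x, rfl⟩ with ⟨z, hz⟩ | ⟨s', hs', z, hz⟩
      · rw [← hxy, ← hz]
        exact hL₀ j z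
      · exact hW.meet s s' (fun e => hs (e ▸ hs')) j y z (hxy.symm.trans hz.symm)
    obtain ⟨z, rfl⟩ := hc.surj j y hy
    rw [← ap_comm H]
    congr 1
    exact typ_injective h.mono (by simpa using hxy)
  refine ⟨Graph.mono_of_injective _ fun j x y hxy => ?_, fun j t => ⟨?_, ?_⟩⟩
  · change typ x = typ y at hxy
    rcases pushout_surjective H x with ⟨x, rfl⟩ | ⟨x, rfl⟩ <;>
    rcases pushout_surjective H y with ⟨y, rfl⟩ | ⟨y, rfl⟩ <;>
    simp only [typ_ap] at hxy
    · rw [typ_injective h.mono hxy]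
    · exact key x y hxy
    · exact (key y x hxy.symm).symm
    · rw [typ_injective (hW.mono_compl s) hxy]
  · rintro ⟨x, rfl⟩
    rcases pushout_surjective H x with ⟨x, rfl⟩ | ⟨x, rfl⟩
    · rcases (h.mem_iff j (typ x)).1 ⟨x, rfl⟩ with ⟨z, hz⟩ | ⟨s', hs', z, hz⟩
      · exact Or.inl ⟨z, by simpa using hz⟩
      · exact Or.inr ⟨s', Or.inr hs', z, by simpa using hz⟩
    · exact Or.inr ⟨s, Or.inl rfl, x, by simp⟩
  · have hold : ((∃ x : L₀.left.obj j, typ x = t) ∨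
        ∃ s ∈ S, ∃ x : (W s).compl.left.obj j, typ x = t) →
        ∃ x : (pushout b (W s).complIncl).left.obj j, typ x = t := fun ht => by
      obtain ⟨x, rfl⟩ := (h.mem_iff j t).2 ht
      exact ⟨ap (pushout.inl b (W s).complIncl) x, by simp⟩
    rintro (ht | ⟨s', rfl | hs', ht⟩)
    · exact hold (Or.inl ht)
    · obtain ⟨x, rfl⟩ := ht
      exact ⟨ap (pushout.inr b (W s').complIncl) x, by simp⟩
    · exact hold (Or.inr ⟨s', hs', ht⟩)

namespace Ext

variable {P : Rule T}

/-- Complementing the shapes of a list whose borders lie in `P.L` attaches each complement once. -/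
theorem foldl_complement (hW : Independent O W) (hP : TypedIn O P.L) (l : List ι)
    (hl : l.Nodup) (hb : ∀ s ∈ l, Nonempty ((W s).border ⟶ P.L)) (S : Set ι)
    (hS : ∀ s ∈ l, s ∉ S) (ρ : Ext P.L) (hρ : ρ.IsConservative O P)
    (h : IsUnion W P.L S ρ.rule.L) :
    (l.foldl (fun ρ s => ρ.complement (W s)) ρ).IsConservative O P ∧
    IsUnion W P.L (S ∪ {s | s ∈ l}) (l.foldl (fun ρ s => ρ.complement (W s)) ρ).rule.L := by
  induction l generalizing S ρ with
  | nil => simpa using ⟨hρ, h⟩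
  | cons s l ih =>
    have hβ : Nonempty ((W s).border ⟶ ρ.rule.L) :=
      (hb s (by simp)).map fun b => b ≫ ρ.emb
    have hU : IsUnion W P.L (insert s S) (ρ.complement (W s)).rule.L := by
      have := h.attach hW hP (hS s (by simp)) hβ.some
      unfold complement
      split_ifs
      exacts [this, this]
    have hl' := List.nodup_cons.1 hl
    have := ih hl'.2 (fun t ht => hb t (by simp [ht])) (insert s S) (by
      rintro t ht (rfl | htS)
      · exact hl'.1 ht
      · exact hS t (by simp [ht]) htS) _
      (isConservative_complement hρ (hW.isFresh s)) hU
    have e : S ∪ {t | t ∈ s :: l} = insert s S ∪ {t | t ∈ l} := by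
      ext t
      simp only [Set.mem_union, Set.mem_ofPred_eq, List.mem_cons, Set.mem_insert_iff]
      tauto
    rw [e]
    exact this

/-- The body of `w` lies in the right-hand side of `P` and is not preserved, but its border is. -/
def CreatesBody (P : Rule T) (w : ComplShape T) : Prop :=
  ∃ (k : w.border ⟶ P.K) (f : w.body ⟶ P.R), k ≫ P.r = w.incl ≫ f ∧
    ¬ ∃ k' : w.body ⟶ P.K, k' ≫ P.r = f

theorem IsConservative.createsBody {ρ : Ext P.L} (hρ : ρ.IsConservative O P) {w : ComplShape T}
    (hw : w.IsFresh O) (h : CreatesBody ρ.rule w) : CreatesBody P w := by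
  obtain ⟨κ, ϱ, -, hκ, hϱ, -, hr⟩ := hρ
  have := hϱ.mono
  obtain ⟨k, f, hkf, hn⟩ := h
  obtain ⟨k, rfl⟩ := hκ.exists_lift hw.border k
  obtain ⟨f, rfl⟩ := hϱ.exists_lift hw.body f
  refine ⟨k, f, ?_, ?_⟩
  · rw [← cancel_mono ϱ, Category.assoc, hr, ← Category.assoc, hkf, Category.assoc]
  · rintro ⟨k', rfl⟩
    exact hn ⟨k' ≫ κ, by rw [Category.assoc, Category.assoc, hr]⟩

theorem foldl_compensateDeletion (hW : Independent O W) (l : List ι) (S : Set ι) (ρ : Ext P.L)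
    (hρ : ρ.IsConservative O P) (h : IsUnion W P.L S ρ.rule.L) :
    ((l.map W).foldl compensateDeletion ρ).IsConservative O P ∧
    IsUnion W P.L S ((l.map W).foldl compensateDeletion ρ).rule.L := by
  induction l generalizing ρ with
  | nil => exact ⟨hρ, h⟩
  | cons s l ih =>
    refine ih _ (isConservative_compensateDeletion hρ (hW.isFresh s)) ?_
    unfold compensateDeletion
    split_ifs
    exacts [h, h]

theorem foldl_completeBorder (hW : Independent O W) (l : List ι) (S : Set ι) (ρ : Ext P.L)
    (hρ : ρ.IsConservative O P) (h : IsUnion W P.L S ρ.rule.L) :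
    ((l.map W).foldl completeBorder ρ).IsConservative O P ∧
    IsUnion W P.L S ((l.map W).foldl completeBorder ρ).rule.L := by
  induction l generalizing ρ with
  | nil => exact ⟨hρ, h⟩
  | cons s l ih =>
    refine ih _ (isConservative_completeBorder hρ (hW.isFresh s)) ?_
    unfold completeBorder
    split_ifs
    exacts [h, h]

/-- Compensating body creation attaches to the left-hand side only complements of shapes of which
`P` creates the body. -/
theorem foldl_compensateCreation (hW : Independent O W) (hP : TypedIn O P.L) (l : List ι)
    (hl : l.Nodup) (S : Set ι) (hS : ∀ s ∈ l, s ∉ S) (ρ : Ext P.L)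
    (hρ : ρ.IsConservative O P) (h : IsUnion W P.L S ρ.rule.L) :
    ((l.map W).foldl compensateCreation ρ).IsConservative O P ∧
    ∃ S', S ⊆ S' ∧ (∀ s ∈ S', s ∈ S ∨ s ∈ l ∧ CreatesBody P (W s)) ∧
      IsUnion W P.L S' ((l.map W).foldl compensateCreation ρ).rule.L := by
  induction l generalizing S ρ with
  | nil => exact ⟨hρ, S, subset_rfl, fun s hs => Or.inl hs, h⟩
  | cons s l ih =>
    have hl' := List.nodup_cons.1 hl
    have hρ' := isConservative_compensateCreation hρ (hW.isFresh s)
    obtain ⟨S₁, hS₁, hS₁', hU⟩ : ∃ S₁, S ⊆ S₁ ∧ (∀ t ∈ S₁, t ∈ S ∨ t = s ∧ CreatesBody P (W s)) ∧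
        IsUnion W P.L S₁ (ρ.compensateCreation (W s)).rule.L := by
      unfold compensateCreation
      split_ifs with hc
      · refine ⟨insert s S, Set.subset_insert _ _, ?_, h.attach hW hP (hS s (by simp)) _⟩
        rintro t (rfl | ht)
        · exact Or.inr ⟨rfl, hρ.createsBody (hW.isFresh t) hc⟩
        · exact Or.inl ht
      · exact ⟨S, subset_rfl, fun t ht => Or.inl ht, h⟩
    obtain ⟨h₁, S', hS', hS'', hU'⟩ := ih hl'.2 S₁ (by
      intro t ht htS
      rcases hS₁' t htS with h | ⟨rfl, -⟩
      · exact hS t (by simp [ht]) h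
      · exact hl'.1 ht) _ hρ' hU
    refine ⟨h₁, S', hS₁.trans hS', fun t ht => ?_, hU'⟩
    rcases hS'' t ht with h | ⟨h, hc⟩
    · rcases hS₁' t h with h | ⟨rfl, hc⟩
      · exact Or.inl h
      · exact Or.inr ⟨by simp, hc⟩
    · exact Or.inr ⟨by simp [h], hc⟩

end Ext
end LeftHandSide

/-! ### The invariant preserving rules of a safe grammar -/

namespace CGG

variable (CG : CGG.{u, v})

/-- The original types, as a subgraph of the enriched type graph. -/
noncomputable def oldTypes : Subfunctor CG.TGbar := Subfunctor.range CG.inTG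

theorem typedIn_map (A : Typed CG.TG) : TypedIn CG.oldTypes ((Over.map CG.inTG).obj A) :=
  fun _ x => ⟨typ x, rfl⟩

theorem mono_map_hom {A : Typed CG.TG} (h : Mono A.hom) : Mono ((Over.map CG.inTG).obj A).hom := by
  have := CG.mono_inTG
  change Mono (A.hom ≫ CG.inTG)
  exact mono_comp _ _

theorem independent_complShape : Independent CG.oldTypes CG.complShape where
  isFresh s :=
    { border := CG.typedIn_map _
      body := CG.typedIn_map _
      mono_border := CG.mono_map_hom (inferInstanceAs (Mono s.1.border.ι))
      mono_body := CG.mono_map_hom (inferInstanceAs (Mono s.1.body.ι))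
      complIncl := by
        refine ⟨(CG.complShape s).mono_compl, fun j x hx => ?_⟩
        obtain ⟨t, ht⟩ := hx
        exact CG.mem_border_of_complTyping_eq_inTG s ht }
  mono_compl s := CG.mono_complTyping s
  meet s s' hs j x x' h := by
    obtain ⟨z, rfl⟩ := CG.mem_border_of_complTyping_eq s s' hs.symm h.symm
    exact ⟨s.1.border.ι.app j z, congrArg (fun f => f.app j z)
      (attach_condition (fun s : CG.shapes => s.1.border.ι)
        (fun s : CG.shapes => s.1.incl) s).symm⟩

variable {CG}

theorem exists_border_hom (safe : CG.Safe) {p : CG.P} {s : Shape CG.TG}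
    (hs : s ∈ CG.ruleShapes p) : Nonempty (s.borderTyped ⟶ (CG.rule p).L) := by
  obtain ⟨c, hc, rfl⟩ := hs
  refine exists_hom_of_typ (safe.1 p).1 ?_
  rintro j ⟨_, x, ⟨-, y, rfl⟩, rfl⟩
  exact ⟨y, (typ_ap c.n y).symm⟩

namespace Enumeration

variable (E : CG.Enumeration)

/-- The first member of the family of rules obtained from `p`: the rule before the completion of
partially created borders. -/
noncomputable def base (p : CG.P) : Ext (CG.ruleBar p).L :=
  let ws := (E.foreign p).map CG.complShape
  ws.foldl Ext.completeBorder
    (ws.foldl Ext.compensateCreation (ws.foldl Ext.compensateDeletion (E.complemented p)))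

theorem base_spec (safe : CG.Safe) (p : CG.P) :
    (E.base p).IsConservative CG.oldTypes (CG.ruleBar p) ∧
    ∃ S : Set CG.shapes, (∀ s, s.1 ∈ CG.ruleShapes p → s ∈ S) ∧
      (∀ s ∈ S, s.1 ∈ CG.ruleShapes p ∨ Ext.CreatesBody (CG.ruleBar p) (CG.complShape s)) ∧
      IsUnion CG.complShape (CG.ruleBar p).L S (E.base p).rule.L := by
  have hW := CG.independent_complShape
  have hL : TypedIn CG.oldTypes (CG.ruleBar p).L := CG.typedIn_map _
  have h₀ := Ext.foldl_complement hW hL (E.own p) (E.nodup.filter _)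
    (fun s hs => (exists_border_hom safe (by simpa [own] using (List.mem_filter.1 hs).2)).map
      fun b => (Over.map CG.inTG).map b) ∅ (by simp) _
    Ext.isConservative_base (isUnion_empty (CG.mono_map_hom (safe.1 p).1))
  have h₁ := Ext.foldl_compensateDeletion hW (E.foreign p) _ _ h₀.1 h₀.2
  obtain ⟨h₂, S, hS, hS', hU⟩ := Ext.foldl_compensateCreation hW hL (E.foreign p)
    (E.nodup.filter _) _ (by
      simp only [foreign, own, List.mem_filter, decide_eq_true_eq, Set.empty_union,
        Set.mem_ofPred_eq]
      exact fun s h h' => h.2 h'.2) _ h₁.1 h₁.2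
  have h₃ := Ext.foldl_completeBorder hW (E.foreign p) _ _ h₂ hU
  refine ⟨h₃.1, S, fun s hs => hS ?_, fun s hs => ?_, h₃.2⟩
  · simp [own, E.complete, hs]
  · rcases hS' s hs with h | h
    · left
      simpa [own, E.complete] using h
    · exact Or.inr h.2

end Enumeration
end CGG

/-! ### The completion of partially created borders -/

section Completion

variable {T : Graph.{u}} (O : Subfunctor T) {L₀ : Typed T}

/-- The rule `ρ` extends `b` by context nodes with types in `O`, and possibly by further created
items of other types: the left-hand and the right-hand side of `ρ` are obtained from those of `b`
by adding the nodes that are added to the interface, up to items of the right-hand side of types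
outside `O`. Moreover, an item of the right-hand side with a type in `O` is the only one of its
type. -/
structure Ext.NodeExtension (b ρ : Ext L₀) where
  a : b.rule.L ⟶ ρ.rule.L
  c : b.rule.K ⟶ ρ.rule.K
  d : b.rule.R ⟶ ρ.rule.R
  mono_a : Mono a
  mono_d : Mono d
  emb : b.emb ≫ a = ρ.emb
  left : IsPushout b.rule.l c a ρ.rule.l
  edge : ∀ e : ρ.rule.L.left.obj .zero, ∃ y, ap a y = e
  node : ∀ x : ρ.rule.L.left.obj .one, (∃ y, ap a y = x) ∨ typ x ∈ O.obj .one
  right : b.rule.r ≫ d = c ≫ ρ.rule.r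
  inter : ∀ (j : WalkingParallelPair) (x : b.rule.R.left.obj j) (y : ρ.rule.K.left.obj j),
    ap d x = ap ρ.rule.r y → ∃ z, ap b.rule.r z = x ∧ ap c z = y
  cover : ∀ (j : WalkingParallelPair) (x : ρ.rule.R.left.obj j), typ x ∈ O.obj j →
    (∃ y, ap d y = x) ∨ ∃ y, ap ρ.rule.r y = x
  typ_inj : ∀ (j : WalkingParallelPair) (x y : ρ.rule.R.left.obj j), typ x ∈ O.obj j →
    typ x = typ y → x = y

variable {O}

theorem Ext.nonempty_nodeExtension_refl (b : Ext L₀)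
    (h : ∀ (j : WalkingParallelPair) (x y : b.rule.R.left.obj j), typ x ∈ O.obj j →
      typ x = typ y → x = y) : Nonempty (b.NodeExtension O b) :=
  ⟨{ a := 𝟙 _
     c := 𝟙 _
     d := 𝟙 _
     mono_a := inferInstance
     mono_d := inferInstance
     emb := Category.comp_id _
     left := IsPushout.of_vert_isIso ⟨by simp⟩
     edge := fun e => ⟨e, rfl⟩
     node := fun x => Or.inl ⟨x, rfl⟩
     right := by simp
     inter := fun _ _ y e => ⟨y, e.symm, rfl⟩
     cover := fun _ x _ => Or.inl ⟨x, rfl⟩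
     typ_inj := h }⟩

theorem typ_interFst {A B : Typed T} {j : WalkingParallelPair} (x : (Ext.inter A B).left.obj j) :
    typ (ap (Ext.interFst A B) x) = typ (ap (Ext.interSnd A B) x) := by
  rw [typ_ap, typ_ap]

/-- Items of two typed graphs with the same type come from the intersection. -/
theorem exists_inter {A B : Typed T} {j : WalkingParallelPair} {x : A.left.obj j}
    {y : B.left.obj j} (h : typ x = typ y) :
    ∃ z, ap (Ext.interFst A B) z = x ∧ ap (Ext.interSnd A B) z = y := by
  have H := (IsPullback.of_hasPullback A.hom B.hom).map ((evaluation _ (Type u)).obj j)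
  exact Types.exists_of_isPullback H x y h

theorem inter_ext {A B : Typed T} {j : WalkingParallelPair} {x y : (Ext.inter A B).left.obj j}
    (h₁ : ap (Ext.interFst A B) x = ap (Ext.interFst A B) y)
    (h₂ : ap (Ext.interSnd A B) x = ap (Ext.interSnd A B) y) : x = y := by
  have H := (IsPullback.of_hasPullback A.hom B.hom).map ((evaluation _ (Type u)).obj j)
  exact Types.ext_of_isPullback H h₁ h₂

/-- Adding the missing part of a border without edges to the interface and to both sides of a
rule, and then items of types outside `O` to the right-hand side, is an extension by context
nodes. -/
theorem Ext.nonempty_nodeExtension_of_isPushout {b ρ ρ' : Ext L₀} (h : b.NodeExtension O ρ)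
    {B R₁ : Typed T} (hB : TypedIn O B) (hBm : Mono B.hom) (hedge : IsEmpty (B.left.obj .zero))
    {i : ρ.rule.R ⟶ R₁} {u : B ⟶ R₁}
    (HR : IsPushout (interFst ρ.rule.R B) (interSnd ρ.rule.R B) i u)
    {k : ρ.rule.K ⟶ ρ'.rule.K} {r' : ρ'.rule.K ⟶ R₁} (HK : IsPushout ρ.rule.r k i r')
    {a : ρ.rule.L ⟶ ρ'.rule.L} (HL : IsPushout ρ.rule.l k a ρ'.rule.l)
    {v : R₁ ⟶ ρ'.rule.R} (hv : GraphGrammar.IsConservative O v) (hr : ρ'.rule.r = r' ≫ v)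
    (hemb : ρ.emb ≫ a = ρ'.emb) : Nonempty (b.NodeExtension O ρ') := by
  have := h.mono_a
  have := h.mono_d
  have := ρ.rule.mono_r
  have := hv.mono
  have hs : Mono (interSnd ρ.rule.R B) := by
    refine mono_of_ap_injective _ fun j x y hxy => inter_ext (h.typ_inj j _ _ ?_ ?_) hxy
    · rw [typ_interFst]
      exact hB j _
    · rw [typ_interFst, hxy, typ_interFst]
  have hi : Mono i := Adhesive.mono_of_isPushout_of_mono_right HR
  have hk : Mono k := by
    have : Mono (k ≫ r') := by rw [← HK.w]; infer_instance
    exact mono_of_mono _ r'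
  have ha : Mono a := Adhesive.mono_of_isPushout_of_mono_right HL
  -- An item of the new interface that is not in the old one is an item of the border.
  have hnew : ∀ (j : WalkingParallelPair) (y : ρ'.rule.K.left.obj j), (∃ z, ap k z = y) ∨
      ∃ z : B.left.obj j, typ z = typ y := by
    intro j y
    rcases pushout_surjective HR (ap r' y) with ⟨x, hx⟩ | ⟨z, hz⟩
    · obtain ⟨z, -, hz⟩ := pushout_inter HK hx
      exact Or.inl ⟨z, hz⟩
    · exact Or.inr ⟨z, by rw [← typ_ap r', ← hz, typ_ap]⟩
  have hL : ∀ (j : WalkingParallelPair) (x : ρ'.rule.L.left.obj j),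
      (∃ y, ap a y = x) ∨ ∃ z : B.left.obj j, typ z = typ x := by
    intro j x
    rcases pushout_surjective HL x with hx | ⟨y, rfl⟩
    · exact Or.inl hx
    · rcases hnew j y with ⟨z, rfl⟩ | ⟨z, hz⟩
      · exact Or.inl ⟨ap ρ.rule.l z, ap_comm HL z⟩
      · exact Or.inr ⟨z, hz.trans (typ_ap _ _).symm⟩
  refine ⟨{
    a := h.a ≫ a
    c := h.c ≫ k
    d := h.d ≫ i ≫ v
    mono_a := mono_comp _ _
    mono_d := mono_comp _ _
    emb := by rw [reassoc_of% h.emb, hemb]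
    left := h.left.paste_vert HL
    edge := fun e => ?_
    node := fun x => ?_
    right := ?_
    inter := fun j x y hxy => ?_
    cover := fun j x hx => ?_
    typ_inj := fun j x y hx hxy => ?_ }⟩
  · rcases hL _ e with ⟨y, rfl⟩ | ⟨z, -⟩
    · obtain ⟨x, rfl⟩ := h.edge y
      exact ⟨x, rfl⟩
    · exact hedge.elim z
  · rcases hL _ x with ⟨y, rfl⟩ | ⟨z, hz⟩
    · rcases h.node y with ⟨x, rfl⟩ | hy
      · exact Or.inl ⟨x, rfl⟩
      · exact Or.inr ((typ_ap _ y).symm ▸ hy)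
    · exact Or.inr (hz ▸ hB _ z)
  · rw [reassoc_of% h.right, reassoc_of% HK.w, hr, Category.assoc]
  · rw [hr] at hxy
    obtain ⟨z, hz, rfl⟩ := pushout_inter HK (ap_injective v hxy)
    obtain ⟨z, rfl, rfl⟩ := h.inter j x z hz.symm
    exact ⟨z, rfl, rfl⟩
  · rw [hr]
    obtain ⟨x, rfl⟩ := hv.surj j x hx
    rw [typ_ap] at hx
    rcases pushout_surjective HK x with ⟨x, rfl⟩ | ⟨y, rfl⟩
    · rw [typ_ap] at hx
      rcases h.cover j x hx with ⟨y, rfl⟩ | ⟨y, rfl⟩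
      · exact Or.inl ⟨y, rfl⟩
      · exact Or.inr ⟨ap k y, congrArg _ (ap_comm HK y).symm⟩
    · exact Or.inr ⟨y, rfl⟩
  · obtain ⟨y, rfl⟩ := hv.surj j y (hxy ▸ hx)
    obtain ⟨x, rfl⟩ := hv.surj j x hx
    rw [typ_ap] at hx
    rw [typ_ap, typ_ap] at hxy
    congr 1
    have hmixed : ∀ (x : ρ.rule.R.left.obj j) (y : B.left.obj j), typ x = typ y →
        ap i x = ap u y := by
      intro x y hxy
      obtain ⟨z, rfl, rfl⟩ := exists_inter hxy
      exact ap_comm HR z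
    rcases pushout_surjective HR x with ⟨x, rfl⟩ | ⟨x, rfl⟩ <;>
    rcases pushout_surjective HR y with ⟨y, rfl⟩ | ⟨y, rfl⟩ <;>
    simp only [typ_ap] at hxy hx
    · rw [h.typ_inj j x y hx hxy]
    · exact hmixed x y hxy
    · exact (hmixed y x hxy.symm).symm
    · rw [typ_injective hBm hxy]

theorem Ext.nonempty_nodeExtension_extend {b ρ : Ext L₀} (h : b.NodeExtension O ρ)
    {w : ComplShape T} (hw : w.IsFresh O) (hedge : IsEmpty (w.border.left.obj .zero))
    (p : Ext.PartialBorder w ρ) : Nonempty (b.NodeExtension O p.extend) :=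
  nonempty_nodeExtension_of_isPushout (ρ' := p.extend) h hw.border hw.mono_border hedge
    (IsPushout.of_hasPushout _ _) p.isPushout (IsPushout.of_hasPushout ρ.rule.l p.k)
    (.of_isPushout (IsPushout.of_hasPushout _ w.complIncl) hw.complIncl) rfl rfl

/-- All members of the family extend the rule from which the completion starts. -/
theorem Ext.completePartial_spec (b : Ext L₀)
    (hb : ∀ (j : WalkingParallelPair) (x y : b.rule.R.left.obj j), typ x ∈ O.obj j →
      typ x = typ y → x = y) (ws : List (ComplShape T))
    (hws : ∀ w ∈ ws, w.IsFresh O ∧ IsEmpty (w.border.left.obj .zero)) :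
    b ∈ b.completePartial ws ∧
      ∀ ρ ∈ b.completePartial ws, Nonempty (b.NodeExtension O ρ) := by
  have key : ∀ rules : List (Ext L₀), b ∈ rules →
      (∀ ρ ∈ rules, Nonempty (b.NodeExtension O ρ)) →
      b ∈ ws.foldl (fun rules w => rules ++ rules.filterMap (extendPartial w)) rules ∧
      ∀ ρ ∈ ws.foldl (fun rules w => rules ++ rules.filterMap (extendPartial w)) rules,
        Nonempty (b.NodeExtension O ρ) := by
    induction ws with
    | nil => exact fun rules h₁ h₂ => ⟨h₁, h₂⟩
    | cons w ws ih =>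
      intro rules h₁ h₂
      refine ih (fun w hw => hws w (by simp [hw])) _ (by simp [h₁]) fun ρ hρ => ?_
      rcases List.mem_append.1 hρ with hρ | hρ
      · exact h₂ ρ hρ
      · obtain ⟨σ, hσ, hρ⟩ := List.mem_filterMap.1 hρ
        unfold extendPartial at hρ
        split_ifs at hρ with hp
        obtain rfl := Option.some_injective _ hρ
        obtain ⟨h⟩ := h₂ σ hσ
        have hw := hws w (by simp)
        exact nonempty_nodeExtension_extend h hw.1 hw.2 _
  refine key [b] (by simp) ?_
  simpa using nonempty_nodeExtension_refl b hb

end Completion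

namespace CGG.Enumeration

variable {CG : CGG.{u, v}} (E : CG.Enumeration)

theorem family_spec (safe : CG.Safe) (p : CG.P) : E.base p ∈ E.family p ∧
    ∀ ρ ∈ E.family p, Nonempty ((E.base p).NodeExtension CG.oldTypes ρ) := by
  obtain ⟨⟨κ, ϱ, -, -, hϱ, -, -⟩, -⟩ := E.base_spec safe p
  refine Ext.completePartial_spec (E.base p) (fun j x y hx hxy =>
    hϱ.eq_of_typ_eq (CG.mono_map_hom (safe.1 p).2.2) hx hxy) _ fun w hw => ?_
  obtain ⟨s, hs, rfl⟩ := List.mem_map.1 hw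
  refine ⟨CG.independent_complShape.isFresh s, ⟨fun x => ?_⟩⟩
  obtain ⟨e, -, -, he, -⟩ : s.1.IsTypeE := by simpa using (List.mem_filter.1 hs).2
  exact (Set.ext_iff.1 he x.1).1 x.2

end CGG.Enumeration

/-! ### Transformations by extended rules -/

section Transformation

variable {T : Graph.{u}} {O : Subfunctor T}

open Classical in
/-- If `ρ` extends `b` by context nodes and has some match in `G'`, then every match of `b` in
`G'` extends to a match of `ρ`. -/
theorem Ext.NodeExtension.exists_match {L₀ : Typed T} {b ρ : Ext L₀} (h : b.NodeExtension O ρ)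
    (hinj : ∀ (j : WalkingParallelPair) (x y : b.rule.L.left.obj j), typ x ∈ O.obj j →
      typ x = typ y → x = y)
    {G' : Typed T} (f : ρ.rule.L ⟶ G') [Mono f] (m₁ : b.rule.L ⟶ G') [Mono m₁] :
    ∃ m' : ρ.rule.L ⟶ G', Mono m' ∧ h.a ≫ m' = m₁ := by
  have := h.mono_a
  -- A new node is sent to its image under `f`; if `m₁` occupies that image by an item `z` (of the
  -- same type), then the image of `z` under `f` is free, since `z` is the only item of its type.
  let φ : ∀ j : WalkingParallelPair, ρ.rule.L.left.obj j → G'.left.obj j := fun j x =>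
    if hx : ∃ y, ap h.a y = x then ap m₁ hx.choose
    else if hz : ∃ z, ap m₁ z = ap f x then ap f (ap h.a hz.choose)
    else ap f x
  have φ_old : ∀ {j : WalkingParallelPair} (y : b.rule.L.left.obj j),
      φ j (ap h.a y) = ap m₁ y := by
    intro j y
    have hx : ∃ y', ap h.a y' = ap h.a y := ⟨y, rfl⟩
    simp only [φ, dif_pos hx]
    rw [ap_injective h.a hx.choose_spec]
  have φ_new : ∀ {j : WalkingParallelPair} (x : ρ.rule.L.left.obj j), (¬ ∃ y, ap h.a y = x) →
      (∃ z, ap m₁ z = ap f x ∧ φ j x = ap f (ap h.a z)) ∨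
        (¬ ∃ z, ap m₁ z = ap f x) ∧ φ j x = ap f x := by
    intro j x hx
    by_cases hz : ∃ z, ap m₁ z = ap f x
    · exact Or.inl ⟨hz.choose, hz.choose_spec, by simp only [φ, dif_neg hx, dif_pos hz]⟩
    · exact Or.inr ⟨hz, by simp only [φ, dif_neg hx, dif_neg hz]⟩
  have typ_φ : ∀ {j : WalkingParallelPair} (x : ρ.rule.L.left.obj j), typ (φ j x) = typ x := by
    intro j x
    by_cases hx : ∃ y, ap h.a y = x
    · obtain ⟨y, rfl⟩ := hx
      simp [φ_old]
    · rcases φ_new x hx with ⟨z, hz, e⟩ | ⟨-, e⟩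
      · rw [e, typ_ap, typ_ap, ← typ_ap m₁ z, hz, typ_ap]
      · rw [e, typ_ap]
  have isOld : ∀ {j : WalkingParallelPair} (x : ρ.rule.L.left.obj j), (¬ ∃ y, ap h.a y = x) →
      typ x ∈ O.obj j := by
    rintro (_ | _) x hx
    · exact absurd (h.edge x) hx
    · exact (h.node x).resolve_left hx
  have free : ∀ {j : WalkingParallelPair} (x : ρ.rule.L.left.obj j), (¬ ∃ y, ap h.a y = x) →
      ∀ y, φ j x ≠ ap m₁ y := by
    intro j x hx y hy
    rcases φ_new x hx with ⟨z, hz, e⟩ | ⟨hn, e⟩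
    · have hzx : typ z = typ x := by rw [← typ_ap m₁ z, hz, typ_ap]
      obtain rfl : z = y := hinj j z y (hzx ▸ isOld x hx) (by
        rw [← typ_ap m₁ y, ← hy, e, typ_ap, typ_ap])
      exact hx ⟨z, ap_injective f (by rw [← e, hy, hz])⟩
    · exact hn ⟨y, by rw [← hy, e]⟩
  have φ_inj : ∀ j, Function.Injective (φ j) := by
    intro j x x' e
    by_cases hx : ∃ y, ap h.a y = x <;> by_cases hx' : ∃ y, ap h.a y = x'
    · obtain ⟨y, rfl⟩ := hx
      obtain ⟨y', rfl⟩ := hx'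
      rw [φ_old, φ_old] at e
      rw [ap_injective m₁ e]
    · obtain ⟨y, rfl⟩ := hx
      rw [φ_old] at e
      exact absurd e.symm (free x' hx' y)
    · obtain ⟨y, rfl⟩ := hx'
      rw [φ_old] at e
      exact absurd e (free x hx y)
    · rcases φ_new x hx with ⟨z, hz, ez⟩ | ⟨hn, ez⟩ <;>
      rcases φ_new x' hx' with ⟨z', hz', ez'⟩ | ⟨hn', ez'⟩ <;> rw [ez, ez'] at e
      · obtain rfl := ap_injective h.a (ap_injective f e)
        exact ap_injective f (hz.symm.trans hz')
      · exact absurd ⟨z, ap_injective f e⟩ hx'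
      · exact absurd ⟨z', ap_injective f e.symm⟩ hx
      · exact ap_injective f e
  have φ_nat : ∀ {i j : WalkingParallelPair} (e : i ⟶ j) (x : ρ.rule.L.left.obj i),
      φ j (ρ.rule.L.left.map e x) = G'.left.map e (φ i x) := by
    intro i j e x
    by_cases hx : ∃ y, ap h.a y = x
    · obtain ⟨y, rfl⟩ := hx
      rw [← ap_map, φ_old, φ_old, ap_map]
    · rcases e with _ | _ | _
      · exact absurd (h.edge x) hx
      · exact absurd (h.edge x) hx
      · change φ _ (ρ.rule.L.left.map (𝟙 _) x) = G'.left.map (𝟙 _) (φ _ x)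
        simp
  let ml : ρ.rule.L.left ⟶ G'.left :=
    { app := fun j => ↾(φ j)
      naturality := fun i j e => by
        ext x
        exact φ_nat e x }
  let m' : ρ.rule.L ⟶ G' := Over.homMk ml (by
    ext j x
    exact typ_φ x)
  exact ⟨m', mono_of_ap_injective m' φ_inj, hom_ext_ap fun j x => φ_old x⟩

/-- A transformation by `P` from `G₀` to `H₀` lifts along an extension of `P`, and along an
extension `g` of `G₀`, to a transformation whose result extends `H₀`, provided that the items
outside `G₀` do not violate the dangling condition. -/
theorem Ext.NodeExtension.exists_dpo {P : Rule T} {b ρ : Ext P.L} (h : b.NodeExtension O ρ)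
    (hb : b.IsConservative O P) {G₀ H₀ G' : Typed T} (hG₀ : TypedIn O G₀)
    (hR : TypedIn O P.R) {m₀ : P.L ⟶ G₀} [Mono m₀] (d : DPO P m₀ H₀)
    {g : G₀ ⟶ G'} (hg : GraphGrammar.IsConservative O g)
    {m' : ρ.rule.L ⟶ G'} [Mono m'] (hm : ρ.emb ≫ m' = m₀ ≫ g)
    (dangling : ∀ e : G'.left.obj .zero, (¬ ∃ x, ap (h.a ≫ m') x = e) → (¬ ∃ x, ap g x = e) →
      ∀ (i : WalkingParallelPair.zero ⟶ .one) (v : b.rule.L.left.obj .one),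
        ap (h.a ≫ m') v = G'.left.map i e → ∃ k, ap b.rule.l k = v) :
    ∃ H' : Typed T, Nonempty (DPO ρ.rule m' H') ∧
      ∃ gH : H₀ ⟶ H', GraphGrammar.IsConservative O gH := by
  obtain ⟨κ, ϱ, hemb, hκ, hϱ, hl, hr⟩ := hb
  have := P.mono_l
  have := b.rule.mono_l
  have := ρ.rule.mono_l
  have := ρ.rule.mono_r
  have := h.mono_a
  have := h.mono_d
  have := hg.mono
  have := hϱ.mono
  have hdg : Mono d.g := Adhesive.mono_of_isPushout_of_mono_left d.left
  rw [← h.emb, Category.assoc] at hm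
  set m₁ := h.a ≫ m' with hm₁
  have em : ∀ {j : WalkingParallelPair} (x : P.L.left.obj j),
      ap m₁ (ap b.emb x) = ap g (ap m₀ x) := fun x => by
    rw [← ap_comp, hm, ap_comp]
  have el : ∀ {j : WalkingParallelPair} (x : P.K.left.obj j),
      ap b.emb (ap P.l x) = ap b.rule.l (ap κ x) := fun x => by
    rw [← ap_comp, hl, ap_comp]
  have er : ∀ {j : WalkingParallelPair} (x : P.K.left.obj j),
      ap ϱ (ap P.r x) = ap b.rule.r (ap κ x) := fun x => by
    rw [← ap_comp, hr, ap_comp]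
  have hold : ∀ {j : WalkingParallelPair} {v : b.rule.L.left.obj j} {y : G₀.left.obj j},
      ap m₁ v = ap g y → ∃ l, ap b.emb l = v ∧ ap m₀ l = y := by
    intro j v y e
    obtain ⟨l, rfl⟩ := hemb.surj j v (by
      rw [← typ_ap m₁, e, typ_ap]
      exact hG₀ j y)
    exact ⟨l, rfl, ap_injective g (by rw [← em, e])⟩
  -- An edge of `G₀` outside the match cannot be incident with a deleted node, since `P` is
  -- applicable to `G₀` and the nodes of `b.rule.L` with types in `O` are those of `P.L`.
  obtain ⟨D', kk, g', hg', HP⟩ := exists_pushoutComplement b.rule.l m₁ (by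
    intro e he i v hv
    by_cases heg : ∃ x, ap g x = e
    · obtain ⟨e, rfl⟩ := heg
      rw [← ap_map] at hv
      obtain ⟨l, rfl, hl'⟩ := hold hv
      rcases pushout_surjective d.left e with ⟨x, rfl⟩ | ⟨e, rfl⟩
      · exact absurd ⟨ap b.emb x, em x⟩ he
      · rw [← ap_map] at hl'
        obtain ⟨k, rfl, -⟩ := pushout_inter d.left hl'
        exact ⟨ap κ k, (el k).symm⟩
    · exact dangling e he heg i v hv)
  obtain ⟨δ, hδ⟩ : ∃ δ : d.D ⟶ D', δ ≫ g' = d.g ≫ g := by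
    refine exists_lift _ _ fun j y => ?_
    rcases pushout_surjective HP (ap (d.g ≫ g) y) with ⟨x, hx⟩ | hy
    · obtain ⟨l, rfl, hl'⟩ := hold (y := ap d.g y) hx
      obtain ⟨k, rfl, rfl⟩ := pushout_inter d.left hl'
      exact ⟨ap kk (ap κ k), by rw [← ap_comm HP, ← el, em, ap_comm d.left, ap_comp]⟩
    · exact hy
  have hδm : Mono δ := by
    have : Mono (δ ≫ g') := by rw [hδ]; infer_instance
    exact mono_of_mono δ g'
  have hδk : d.k ≫ δ = κ ≫ kk := by
    rw [← cancel_mono g', Category.assoc, Category.assoc, hδ, ← HP.w, ← reassoc_of% d.left.w,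
      ← reassoc_of% hl, hm]
  -- The context nodes of `ρ` avoid the image of `b.rule.L`, hence they are mapped to `D'`, so that
  -- `D'` is a pushout complement for `ρ` as well.
  obtain ⟨k', hk'⟩ : ∃ k' : ρ.rule.K ⟶ D', k' ≫ g' = ρ.rule.l ≫ m' := by
    refine exists_lift _ _ fun j y => ?_
    rcases pushout_surjective HP (ap (ρ.rule.l ≫ m') y) with ⟨x, hx⟩ | hy
    · obtain ⟨k, rfl, rfl⟩ := pushout_inter h.left (ap_injective m' hx)
      exact ⟨ap kk k, by rw [← ap_comm HP, hx]⟩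
    · exact hy
  have hk'm : Mono k' := by
    have : Mono (k' ≫ g') := by rw [hk']; infer_instance
    exact mono_of_mono k' g'
  have hck : h.c ≫ k' = kk := by
    rw [← cancel_mono g', Category.assoc, hk', ← HP.w, hm₁, ← reassoc_of% h.left.w]
  have eck : ∀ {j : WalkingParallelPair} (x : b.rule.K.left.obj j),
      ap k' (ap h.c x) = ap kk x := fun x => by
    rw [← ap_comp, hck]
  have HL : IsPushout ρ.rule.l k' m' g' := by
    refine isPushout_of_union hk'.symm ?_ ?_
    · intro j x
      rcases pushout_surjective HP x with ⟨y, rfl⟩ | hy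
      · exact Or.inl ⟨ap h.a y, rfl⟩
      · exact Or.inr hy
    · intro j x z e
      rcases pushout_surjective h.left x with ⟨x, rfl⟩ | ⟨y, rfl⟩
      · obtain ⟨k, rfl, rfl⟩ := pushout_inter HP e
        exact ⟨ap h.c k, (ap_comm h.left k).symm, eck k⟩
      · refine ⟨y, rfl, ap_injective g' ?_⟩
        rw [← e, ← ap_comp, hk', ap_comp]
  have HR := IsPushout.of_hasPushout ρ.rule.r k'
  have hinl := mono_inl ρ.rule.r k'
  have hinr := mono_inr ρ.rule.r k'
  refine ⟨pushout ρ.rule.r k', ⟨⟨D', g', pushout.inr _ _, k', pushout.inl _ _, HL, HR⟩⟩, ?_⟩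
  -- The results `H₀` and `H'` are compared by the universal property of `H₀`.
  have w : P.r ≫ ϱ ≫ h.d ≫ pushout.inl ρ.rule.r k' = d.k ≫ δ ≫ pushout.inr ρ.rule.r k' := by
    rw [reassoc_of% hr, reassoc_of% h.right, reassoc_of% hδk, pushout.condition,
      reassoc_of% hck]
  let gH := d.right.desc (ϱ ≫ h.d ≫ pushout.inl ρ.rule.r k') (δ ≫ pushout.inr ρ.rule.r k') w
  have gl : ∀ {j : WalkingParallelPair} (x : P.R.left.obj j),
      ap gH (ap d.comatch x) = ap (pushout.inl ρ.rule.r k') (ap h.d (ap ϱ x)) := fun x => by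
    rw [← ap_comp, d.right.inl_desc]; rfl
  have gr : ∀ {j : WalkingParallelPair} (x : d.D.left.obj j),
      ap gH (ap d.h x) = ap (pushout.inr ρ.rule.r k') (ap δ x) := fun x => by
    rw [← ap_comp, d.right.inr_desc]; rfl
  have mixed : ∀ {j : WalkingParallelPair} (x : P.R.left.obj j) (z : d.D.left.obj j),
      ap gH (ap d.comatch x) = ap gH (ap d.h z) → ap d.comatch x = ap d.h z := by
    intro j x z e
    rw [gl, gr] at e
    obtain ⟨y, hy, hz⟩ := pushout_inter HR e
    obtain ⟨v, hv, rfl⟩ := h.inter j _ y hy.symm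
    obtain ⟨k, rfl⟩ := hκ.surj j v (by
      rw [← typ_ap b.rule.r, hv, typ_ap]
      exact hR j x)
    obtain rfl : ap P.r k = x := ap_injective ϱ (by rw [er, hv])
    rw [eck, ← ap_comp, ← hδk, ap_comp] at hz
    rw [← ap_injective δ hz]
    exact ap_comm d.right k
  refine ⟨gH, mono_of_ap_injective gH fun j x y e => ?_, fun j x hx => ?_⟩
  · rcases pushout_surjective d.right x with ⟨x, rfl⟩ | ⟨x, rfl⟩ <;>
    rcases pushout_surjective d.right y with ⟨y, rfl⟩ | ⟨y, rfl⟩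
    · rw [gl, gl] at e
      rw [ap_injective ϱ (ap_injective h.d (ap_injective _ e))]
    · exact mixed x y e
    · exact (mixed y x e.symm).symm
    · rw [gr, gr] at e
      rw [ap_injective δ (ap_injective _ e)]
  · have inr_mem : ∀ z : D'.left.obj j, typ z ∈ O.obj j →
        ∃ y, ap gH y = ap (pushout.inr ρ.rule.r k') z := by
      intro z hz
      obtain ⟨y, hy⟩ := hg.surj j (ap g' z) (by simpa using hz)
      rcases pushout_surjective d.left y with ⟨l, rfl⟩ | ⟨y, rfl⟩
      · rw [← em] at hy
        obtain ⟨k, hk, rfl⟩ := pushout_inter HP hy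
        obtain ⟨k, rfl⟩ := hκ.surj j k (by simpa using hz)
        refine ⟨ap d.h (ap d.k k), ?_⟩
        rw [gr, ← ap_comp d.k, hδk, ap_comp]
      · refine ⟨ap d.h y, ?_⟩
        rw [gr]
        congr 1
        apply ap_injective g'
        rw [← hy, ← ap_comp, hδ, ap_comp]
    rcases pushout_surjective HR x with ⟨x, rfl⟩ | ⟨z, rfl⟩
    · rw [typ_ap] at hx
      rcases h.cover j x hx with ⟨y, rfl⟩ | ⟨y, rfl⟩
      · obtain ⟨x, rfl⟩ := hϱ.surj j y (by simpa using hx)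
        exact ⟨_, gl x⟩
      · rw [ap_comm HR]
        exact inr_mem _ (by simpa using hx)
    · exact inr_mem z (by simpa using hx)

end Transformation

/-! ### Reflection of derivations -/

/-- Pulling the typing back along `ι` recovers a graph from each extension of it by items of
new types. -/
theorem nonempty_retype_iso {T T' : Graph.{u}} (ι : T ⟶ T') [Mono ι] {G : Typed T} {G' : Typed T'}
    {g : (Over.map ι).obj G ⟶ G'} (hg : IsConservative (Subfunctor.range ι) g) :
    Nonempty ((retype ι (𝟙 T)).obj G' ≅ G) := by
  have hm := hg.mono
  have H : IsPullback g.left G.hom G'.hom ι := by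
    refine IsPullback.of_forall_isPullback_app fun j => ?_
    refine (Types.isPullback_iff _ _ _ _).2 ⟨?_, ?_, ?_⟩
    · ext x
      exact typ_ap g x
    · exact fun x y h => ap_injective g h.1
    · intro x t h
      obtain ⟨y, rfl⟩ := hg.surj j x ⟨t, h.symm⟩
      refine ⟨y, rfl, Graph.app_injective ι j ?_⟩
      rw [← h]
      exact (typ_ap g y).symm
  refine ⟨Over.isoMk H.isoPullback.symm ?_⟩
  change H.isoPullback.inv ≫ G.hom = pullback.snd G'.hom ι ≫ 𝟙 T
  rw [H.isoPullback_inv_snd, Category.comp_id]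

/-- Negative constraints are reflected along extensions by items of new types. -/
theorem Constraint.SatisfiedBy.lift {T T' : Graph.{u}} (ι : T ⟶ T') [Mono ι] {L G : Typed T}
    {c : Constraint L} {m : L ⟶ G} (h : c.SatisfiedBy m) {G' L' : Typed T'}
    {g : (Over.map ι).obj G ⟶ G'} (hg : IsConservative (Subfunctor.range ι) g)
    {a : (Over.map ι).obj L ⟶ L'} (ha : Mono a) (m' : L' ⟶ G')
    (w : a ≫ m' = (Over.map ι).map m ≫ g) : ((c.map ι).lift a).SatisfiedBy m' := by
  rintro ⟨q, hq, hqm⟩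
  have hgm := hg.mono
  have hn : Mono (pushout.inr a (c.map ι).n) := mono_inr _ _
  obtain ⟨k, hk⟩ := hg.exists_lift (C := (Over.map ι).obj c.N) (fun j x => ⟨typ x, rfl⟩)
    (pushout.inr a (c.map ι).n ≫ q)
  have hkm : Mono k := by
    have : Mono (k ≫ g) := by rw [hk]; exact @mono_comp _ _ _ _ _ _ hn _ hq
    exact mono_of_mono k g
  let k₀ : c.N ⟶ G := Over.homMk k.left (by
    rw [← cancel_mono ι, Category.assoc]
    exact Over.w k)
  have hk₀ : (Over.map ι).map k₀ = k := by
    ext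
    rfl
  have e : (Over.map ι).map (c.n ≫ k₀) = (Over.map ι).map m := by
    rw [← cancel_mono g, Functor.map_comp, hk₀, Category.assoc, hk, ← w, ← hqm]
    exact (pushout.condition_assoc _).symm
  refine h ⟨k₀, mono_of_ap_injective k₀ fun j => ap_injective k, ?_⟩
  refine hom_ext_ap fun j x => ?_
  exact congrArg (fun t : (Over.map ι).obj L ⟶ (Over.map ι).obj G => ap t x) e

/-- Rules are preordered by the subrule relation. -/
abbrev Rule.subrulePreorder {T : Graph.{u}} : Preorder (Rule T) where
  le := Rule.Subrule
  le_refl _ := ⟨𝟙 _, 𝟙 _, 𝟙 _, inferInstance, inferInstance, inferInstance, by simp, by simp⟩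
  le_trans := by
    rintro p q r ⟨a, b, c, ha, hb, hc, h₁, h₂⟩ ⟨a', b', c', ha', hb', hc', h₁', h₂'⟩
    exact ⟨a ≫ a', b ≫ b', c ≫ c', mono_comp _ _, mono_comp _ _, mono_comp _ _,
      by rw [reassoc_of% h₁, h₁', Category.assoc], by rw [reassoc_of% h₂, h₂', Category.assoc]⟩

namespace CGG.Enumeration

variable {CG : CGG.{u, v}} (E : CG.Enumeration)

/-- Among the rules obtained from `p` that have a match in `G'`, there is a maximal one. -/
theorem exists_maximal (p : CG.P) (G' : Typed CG.TGbar) (i₀ : Fin (E.family p).length)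
    (h₀ : ∃ f : ((E.family p).get i₀).rule.L ⟶ G', Mono f) :
    ∃ i : Fin (E.family p).length, (∃ f : ((E.family p).get i).rule.L ⟶ G', Mono f) ∧
      E.Maximal ⟨p, i⟩ G' := by
  let _ := Rule.subrulePreorder (T := CG.TGbar)
  obtain ⟨i, hi, hmax⟩ := (Set.toFinite
    {i | ∃ f : ((E.family p).get i).rule.L ⟶ G', Mono f}).exists_maximalFor
      (fun i => ((E.family p).get i).rule) _ ⟨i₀, h₀⟩
  refine ⟨i, hi, ?_⟩
  rintro ⟨p', j⟩ hp hj hij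
  obtain rfl : p' = p := hp
  exact hmax hj hij

/-- A transformation is reflected from every extension `G'` of `G` by items of new types to which
the match extends as a match of the first rule of the family, such that the added items do not
violate the dangling condition. -/
theorem reflectedFrom_of_match (safe : CG.Safe) {p : CG.P} {G H : Typed CG.TG}
    {m : (CG.rule p).L ⟶ G} (step : CG.Step p m H) {G' : Typed CG.TGbar}
    {g : (Over.map CG.inTG).obj G ⟶ G'} (hg : IsConservative CG.oldTypes g)
    {m₁ : (E.base p).rule.L ⟶ G'} (hm₁ : Mono m₁)
    (w : (E.base p).emb ≫ m₁ = (Over.map CG.inTG).map m ≫ g)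
    (dangling : ∀ e : G'.left.obj .zero, (¬ ∃ x, ap m₁ x = e) → (¬ ∃ x, ap g x = e) →
      ∀ (i : WalkingParallelPair.zero ⟶ .one) (v : (E.base p).rule.L.left.obj .one),
        ap m₁ v = G'.left.map i e → ∃ k, ap (E.base p).rule.l k = v) :
    E.ReflectedFrom p G H G' := by
  obtain ⟨hm, hnac, ⟨d⟩⟩ := step
  have hι := CG.mono_inTG
  obtain ⟨hbase, hfam⟩ := E.family_spec safe p
  have hb := (E.base_spec safe p).1
  obtain ⟨i₀, hi₀⟩ := List.mem_iff_get.1 hbase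
  obtain ⟨i, ⟨f, hf⟩, hmax⟩ := E.exists_maximal p G' i₀ (by rw [hi₀]; exact ⟨m₁, hm₁⟩)
  obtain ⟨h⟩ := hfam _ (List.get_mem (E.family p) i)
  obtain ⟨κ, ϱ, hemb, -⟩ := id hb
  have hembm := hemb.mono
  have ham := h.mono_a
  obtain ⟨m', hm', e⟩ := h.exists_match (fun j x y hx hxy =>
    hemb.eq_of_typ_eq (CG.mono_map_hom (safe.1 p).1) hx hxy) f m₁
  have w' : ((E.family p).get i).emb ≫ m' = (Over.map CG.inTG).map m ≫ g := by
    rw [← h.emb, Category.assoc, e, w]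
  have hmm : @Mono _ _ (CG.ruleBar p).L _ ((Over.map CG.inTG).map m) := mono_map _ _
  let d' : DPO (CG.ruleBar p) ((Over.map CG.inTG).map m) ((Over.map CG.inTG).obj H) :=
    { D := (Over.map CG.inTG).obj d.D
      g := (Over.map CG.inTG).map d.g
      h := (Over.map CG.inTG).map d.h
      k := (Over.map CG.inTG).map d.k
      comatch := (Over.map CG.inTG).map d.comatch
      left := d.left.map (Over.map CG.inTG)
      right := d.right.map (Over.map CG.inTG) }
  obtain ⟨H', hH', gH, hgH⟩ := h.exists_dpo hb (CG.typedIn_map G) (CG.typedIn_map _) d' hg w'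
    (by rw [e]; exact dangling)
  refine ⟨H', ⟨p, i⟩, m', ⟨hm', ?_, hH'⟩, hmax, rfl, nonempty_retype_iso CG.inTG hg,
    nonempty_retype_iso CG.inTG hgH⟩
  rintro _ ⟨c, hc, rfl⟩
  have hembi : Mono ((E.family p).get i).emb := by
    rw [← h.emb]
    exact mono_comp _ _
  exact (hnac c hc).lift CG.inTG hg hembi m' w'

/-- Each transformation is reflected from the graph obtained by gluing the left-hand side of the
first rule of the family to `G`. -/
theorem exists_reflectedFrom (safe : CG.Safe) {p : CG.P} {G H : Typed CG.TG}
    {m : (CG.rule p).L ⟶ G} (step : CG.Step p m H) :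
    ∃ G' : Typed CG.TGbar, E.ReflectedFrom p G H G' := by
  obtain ⟨κ, ϱ, hemb, -⟩ := (E.base_spec safe p).1
  have hm := step.1
  have hmm : Mono ((Over.map CG.inTG).map m) := mono_map _ _
  have HP := IsPushout.of_hasPushout (E.base p).emb ((Over.map CG.inTG).map m)
  refine ⟨_, E.reflectedFrom_of_match safe step (IsConservative.of_isPushout HP.flip hemb)
    (m₁ := pushout.inl _ _) (@mono_inl _ _ _ _ _ _ hmm) HP.w fun e h₁ h₂ => ?_⟩
  exact absurd (pushout_surjective HP e) (not_or.2 ⟨h₁, h₂⟩)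

end CGG.Enumeration

/-! ### Reflection from the closure -/

/-- A graph that contains the match of `p` and the body of one of its constraints contains a
forbidden occurrence of the constraint. -/
theorem Constraint.SatisfiedBy.isEmpty_body {T : Graph.{u}} {L G : Typed T} {c : Constraint L}
    {m : L ⟶ G} (h : c.SatisfiedBy m) (hN : Mono c.N.hom) (hG : Mono G.hom) :
    IsEmpty (c.shape.bodyTyped ⟶ G) := by
  refine ⟨fun b => ?_⟩
  obtain ⟨q⟩ : Nonempty (c.N ⟶ G) := by
    refine exists_hom_of_typ hG fun j x => ?_
    by_cases hx : x ∈ (Subfunctor.range c.n.left).obj j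
    · obtain ⟨l, rfl⟩ := hx
      exact ⟨ap m l, (typ_ap m l).trans (typ_ap c.n l).symm⟩
    · have hneg : x ∈ c.negative.obj j := by
        rintro _ ⟨S, hS, rfl⟩
        exact hS j x hx
      exact ⟨ap b ⟨typ x, x, hneg, rfl⟩, typ_ap b _⟩
  exact h ⟨q, mono_of_typ_injective q hN, hom_subsingleton hG _ _⟩

namespace CGG

variable {CG : CGG.{u, v}}

/-- If the result of a transformation is injectively typed and the rule does not recreate what it
deletes, then a body that the rule creates is missing in the original graph. -/
theorem isEmpty_body_of_createsBody {p : CG.P} {G H : Typed CG.TG} {m : (CG.rule p).L ⟶ G}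
    (d : DPO (CG.rule p) m H) (hH : Mono H.hom) (hrec : (CG.rule p).NoRecreation)
    {s : CG.shapes} (h : Ext.CreatesBody (CG.ruleBar p) (CG.complShape s)) :
    IsEmpty (s.1.bodyTyped ⟶ G) := by
  have hι := CG.mono_inTG
  have hr := (CG.rule p).mono_r
  have hr' := (CG.ruleBar p).mono_r
  obtain ⟨k, f, -, hn⟩ := h
  refine ⟨fun b => hn (exists_lift f _ fun j x => ?_)⟩
  let x' : s.1.bodyTyped.left.obj j := x
  let y : (CG.rule p).R.left.obj j := ap f x
  have hy : typ y = typ (ap b x') := by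
    rw [typ_ap]
    exact Graph.app_injective CG.inTG j (typ_ap f x)
  change ∃ z : (CG.rule p).K.left.obj j, ap (CG.rule p).r z = y
  rcases pushout_surjective d.left (ap b x') with ⟨l, hl⟩ | ⟨z, hz⟩
  · have hrec' := hrec.map ((evaluation _ (Type u)).obj j)
    obtain ⟨z, -, hz⟩ := Types.exists_of_isPullback hrec' l y (by
      change typ l = typ y
      rw [hy, ← hl, typ_ap])
    exact ⟨z, hz⟩
  · obtain ⟨z, hz, -⟩ := pushout_inter d.right (b := y) (c := z) (typ_injective hH (by
      rw [typ_ap, typ_ap, hy, ← hz, typ_ap]))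
    exact ⟨z, hz⟩

/-- The inclusion of a graph into its closure. -/
noncomputable def toClosure (G : Typed CG.TG) : (Over.map CG.inTG).obj G ⟶ CG.closure G :=
  attachBase (fun s : CG.Missing G => (Over.map CG.inTG).map s.2.1.some)
    (fun s : CG.Missing G => (CG.complShape s.1).complIncl)

/-- The inclusion of the complement of a missing body into the closure. -/
noncomputable def pieceToClosure (G : Typed CG.TG) (s : CG.Missing G) :
    (CG.complShape s.1).compl ⟶ CG.closure G :=
  attachPiece (fun s : CG.Missing G => (Over.map CG.inTG).map s.2.1.some)
    (fun s : CG.Missing G => (CG.complShape s.1).complIncl) s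

theorem closure_surjective (G : Typed CG.TG) {j : WalkingParallelPair}
    (x : (CG.closure G).left.obj j) : (∃ y, ap (toClosure G) y = x) ∨
      ∃ s y, ap (pieceToClosure G s) y = x :=
  attach_surjective _ _ x

/-- The items of an original type in a complement are glued to items of `G`. -/
theorem exists_toClosure_eq (G : Typed CG.TG) {j : WalkingParallelPair} (s : CG.Missing G)
    (y : (CG.complShape s.1).compl.left.obj j) (hy : typ y ∈ CG.oldTypes.obj j) :
    ∃ x, ap (toClosure G) x = ap (pieceToClosure G s) y := by
  obtain ⟨z, rfl⟩ := (CG.independent_complShape.isFresh s.1).complIncl.surj j y hy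
  exact ⟨_, congrArg (fun t => ap t z) (attach_condition
    (fun s : CG.Missing G => (Over.map CG.inTG).map s.2.1.some)
    (fun s : CG.Missing G => (CG.complShape s.1).complIncl) s).symm⟩

theorem isConservative_toClosure {G : Typed CG.TG} (hG : Mono G.hom) :
    IsConservative CG.oldTypes (toClosure G) := by
  refine ⟨mono_of_typ_injective _ (CG.mono_map_hom hG), fun j x hx => ?_⟩
  rcases closure_surjective G x with h | ⟨s, y, rfl⟩
  · exact h
  · exact exists_toClosure_eq G s y (by simpa using hx)

/-- The closure of an injectively typed graph is the union of the graph and of the complements of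
the missing bodies. -/
theorem isUnion_closure {G : Typed CG.TG} (hG : Mono G.hom) :
    IsUnion CG.complShape ((Over.map CG.inTG).obj G)
      {s | Nonempty (s.1.borderTyped ⟶ G) ∧ IsEmpty (s.1.bodyTyped ⟶ G)} (CG.closure G) := by
  have hW := CG.independent_complShape
  refine ⟨Graph.mono_of_injective _ fun j x y h => ?_, fun j t => ⟨?_, ?_⟩⟩
  · change typ x = typ y at h
    have key : ∀ x y : (CG.closure G).left.obj j, typ x = typ y →
        typ x ∈ CG.oldTypes.obj j → x = y := fun x y h hx =>
      (isConservative_toClosure hG).eq_of_typ_eq (CG.mono_map_hom hG) hx h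
    rcases closure_surjective G x with ⟨x, rfl⟩ | ⟨s, x, rfl⟩
    · exact key _ _ h (by simpa using CG.typedIn_map G j x)
    · rcases closure_surjective G y with ⟨y, rfl⟩ | ⟨s', y, rfl⟩
      · exact key _ _ h (by simpa [h] using CG.typedIn_map G j y)
      · by_cases hs : s.1 = s'.1
        · obtain rfl : s = s' := Subtype.ext hs
          rw [typ_ap, typ_ap] at h
          rw [typ_injective (hW.mono_compl s.1) h]
        · refine key _ _ h ?_
          rw [typ_ap, typ_ap] at h
          rw [typ_ap]
          exact hW.meet _ _ hs j x y h
  · rintro ⟨x, rfl⟩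
    rcases closure_surjective G x with ⟨x, rfl⟩ | ⟨s, x, rfl⟩
    · exact Or.inl ⟨x, (typ_ap _ _).symm⟩
    · exact Or.inr ⟨s.1, s.2, x, (typ_ap _ _).symm⟩
  · rintro (⟨x, rfl⟩ | ⟨s, hs, x, rfl⟩)
    · exact ⟨ap (toClosure G) x, typ_ap _ _⟩
    · exact ⟨ap (pieceToClosure G ⟨s, hs⟩) x, typ_ap _ _⟩

namespace Enumeration

variable (E : CG.Enumeration)

/-- As subgraphs of the enriched type graph, the left-hand side of the first rule of the family is
contained in the closure of `G`: the shapes of the constraints of `p` and the bodies that `p`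
creates are missing in `G`. The dangling condition holds because a complement that is not in the
left-hand side is attached along a border that `p` preserves. -/
theorem reflectedFrom_closure (safe : CG.Safe) {p : CG.P} {G H : Typed CG.TG}
    {m : (CG.rule p).L ⟶ G} (step : CG.Step p m H) (hG : Mono G.hom) (hH : Mono H.hom)
    (hrec : (CG.rule p).NoRecreation)
    (hpres : ∀ s ∈ CG.shapes, s ∉ CG.ruleShapes p → Nonempty (s.borderTyped ⟶ G) →
      IsEmpty (s.bodyTyped ⟶ G) → (CG.rule p).Preserves s.border) :
    E.ReflectedFrom p G H (CG.closure G) := by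
  have hι := CG.mono_inTG
  have hW := CG.independent_complShape
  obtain ⟨⟨κ, ϱ, hemb, hκ, -, hl, -⟩, S, hown, hS, hU⟩ := E.base_spec safe p
  obtain ⟨d⟩ := step.2.2
  have hcl := isUnion_closure hG
  have hmissing : ∀ s ∈ S, Nonempty (s.1.borderTyped ⟶ G) ∧ IsEmpty (s.1.bodyTyped ⟶ G) := by
    intro s hs
    rcases hS s hs with h | h
    · refine ⟨(exists_border_hom safe h).map fun b => b ≫ m, ?_⟩
      obtain ⟨c, hc, hcs⟩ := h
      rw [← hcs]
      exact (step.2.1 c hc).isEmpty_body (safe.2.1 p c hc) hG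
    · refine ⟨?_, isEmpty_body_of_createsBody d hH hrec h⟩
      obtain ⟨k, -⟩ := h
      refine exists_hom_of_typ hG fun j x => ?_
      let z : (CG.rule p).K.left.obj j := ap k x
      refine ⟨ap m (ap (CG.rule p).l z), ?_⟩
      rw [typ_ap, typ_ap]
      exact Graph.app_injective CG.inTG j (typ_ap k x)
  obtain ⟨m₁⟩ : Nonempty ((E.base p).rule.L ⟶ CG.closure G) := by
    refine exists_hom_of_typ hcl.mono fun j x => (hcl.mem_iff j _).2 ?_
    rcases (hU.mem_iff j (typ x)).1 ⟨x, rfl⟩ with ⟨y, hy⟩ | ⟨s, hs, hy⟩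
    · exact Or.inl ⟨ap ((Over.map CG.inTG).map m) y, (typ_ap _ _).trans hy⟩
    · exact Or.inr ⟨s, hmissing s hs, hy⟩
  refine E.reflectedFrom_of_match safe step (isConservative_toClosure hG)
    (mono_of_typ_injective m₁ hU.mono) (hom_subsingleton hcl.mono _ _) ?_
  intro e he heG i v hv
  obtain ⟨s, y, rfl⟩ := (closure_surjective G e).resolve_left heG
  have hsS : s.1 ∉ S := by
    intro hs
    obtain ⟨x, hx⟩ := (hU.mem_iff _ (typ y)).2 (Or.inr ⟨s.1, hs, y, rfl⟩)
    exact he ⟨x, typ_injective hcl.mono (by rw [typ_ap, typ_ap, hx])⟩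
  rw [← ap_map] at hv
  have htv : typ v = typ ((CG.complShape s.1).compl.left.map i y) := by
    rw [← typ_ap m₁, hv, typ_ap]
  have hvO : typ v ∈ CG.oldTypes.obj .one := by
    rcases (hU.mem_iff _ (typ v)).1 ⟨v, rfl⟩ with ⟨l, hl'⟩ | ⟨s', hs', x, hx⟩
    · rw [← hl']
      exact CG.typedIn_map _ _ l
    · rw [← hx]
      exact hW.meet s' s.1 (fun h => hsS (h ▸ hs')) _ x _ (hx.trans htv)
  -- The endpoint lies in the border of `s`, which `p` preserves, as `s` is foreign to `p`.
  obtain ⟨l, rfl⟩ := hemb.surj _ v hvO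
  obtain ⟨z, hz⟩ := (hW.isFresh s.1).complIncl.surj _ _ (htv ▸ hvO)
  let l' : (CG.rule p).L.left.obj .one := l
  have hlz : typ l' = z.1 := by
    refine Graph.app_injective CG.inTG _ ?_
    change typ l = typ z
    rw [← typ_ap (E.base p).emb, htv, ← hz, typ_ap]
  have hmem : typ l' ∈ s.1.1.border.obj .one := hlz ▸ z.2
  obtain ⟨k, hk⟩ := hpres s.1.1 s.1.2 (fun h => hsS (hown s.1 h)) s.2.1 s.2.2 .one hmem
  let k' : (CG.ruleBar p).K.left.obj .one := k
  have hk' : ap (CG.ruleBar p).l k' = l := hk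
  refine ⟨ap κ k', ?_⟩
  rw [← hk', ← ap_comp, ← hl, ap_comp]

end Enumeration
end CGG
end GraphGrammar

open GraphGrammar in
theorem mainTheorem1 (CG : CGG.{u, v}) (safe : CG.Safe)
    (incremental : ∀ p, ∀ c ∈ CG.nac p, c.Incremental) (E : CG.Enumeration)
    (p : CG.P) (G H : Typed CG.TG) (m : (CG.rule p).L ⟶ G) (step : CG.Step p m H) :
    (∃ G' : Typed E.enriched.TG, E.ReflectedFrom p G H G') ∧
    (Mono G.hom → Mono H.hom → (CG.rule p).NoRecreation →
      (∀ s ∈ CG.shapes, s ∉ CG.ruleShapes p → Nonempty (s.borderTyped ⟶ G) →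
        IsEmpty (s.bodyTyped ⟶ G) → (CG.rule p).Preserves s.border) →
      E.ReflectedFrom p G H (CG.closure G)) :=
  ⟨E.exists_reflectedFrom safe step, E.reflectedFrom_closure safe step⟩
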